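/- All graphs are finite and simple. For graphs $G$ and $H$, let $r(G,H)$ be the smallest positive integer $N$ such that every red-blue colouring of the edges of $K_N$ contains a red subgraph isomorphic to $G$ or a blue subgraph isomorphic to $H$. For $k\ge 1$ let $B_k=K_2+\overline{K_k}$ be the book on $k+2$ vertices, i.e. $k$ triangles sharing a common edge. Let $\chi(H)$ be the chromatic number of $H$, and let $s(H)$ be the cardinality of the smallest colour class, taken over all proper colourings of $H$ with $\chi(H)$ colours. A connected graph $G$ on $n$ vertices is called $H$-good if $r(G,H)=(n-1)(\chi(H)-1)+s(H)$. Theorem. Let $k\ge 1$ and $n\ge 34k^3$ be integers. If $G$ is a connected graph with $n$ vertices and at most $n\left(1+\frac{1}{119k^2+62k}\right)$ edges, then $$r(G,B_k)=2n-1,$$ and $G$ is $B_k$-good. -/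

import Mathlib

open scoped SimpleGraph

/-- The **Ramsey number** `r(G, H)`: the smallest positive integer `N` such that every red-blue
colouring of the edges of the complete graph on `N` vertices contains a red copy of `G` or a blue
copy of `H`. A red-blue colouring is given by its graph `R` of red edges; the graph of blue edges
is then the complement `Rᶜ`. Copies are not necessarily induced. -/
noncomputable def ramseyNumber {V W : Type*} (G : SimpleGraph V) (H : SimpleGraph W) : ℕ :=
  sInf {N : ℕ | 0 < N ∧ ∀ R : SimpleGraph (Fin N), G ⊑ R ∨ H ⊑ Rᶜ}

/-- The **join** `G + H`: the disjoint union of `G` and `H` together with all the edges between a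
vertex of `G` and a vertex of `H`. -/
def graphJoin {V W : Type*} (G : SimpleGraph V) (H : SimpleGraph W) : SimpleGraph (V ⊕ W) :=
  (G ⊕g H) ⊔ completeBipartiteGraph V W

/-- The **book** `B_k = K_2 + \overline{K_k}`: `k` triangles sharing a common edge. -/
def book (k : ℕ) : SimpleGraph (Fin 2 ⊕ Fin k) :=
  graphJoin (⊤ : SimpleGraph (Fin 2)) (⊥ : SimpleGraph (Fin k))

/-- The **chromatic surplus** of a finite graph `H`: the cardinality of the smallest colour class,
taken over all proper colourings of `H` with `χ(H)` colours. -/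
noncomputable def chromaticSurplus {W : Type*} (H : SimpleGraph W) : ℕ :=
  sInf {m : ℕ | ∃ (C : H.Coloring (Fin H.chromaticNumber.toNat))
    (c : Fin H.chromaticNumber.toNat), m = (C.colorClass c).ncard}

/-- A connected finite graph `G` is **`H`-good** if `r(G, H) = (|G| - 1)(χ(H) - 1) + s(H)`, with
`χ(H)` the chromatic number and `s(H)` the chromatic surplus of `H`. The equation is written in
`ℤ`, so that the subtractions are the true ones. -/
def IsRamseyGood {V W : Type*} (G : SimpleGraph V) (H : SimpleGraph W) : Prop :=
  G.Connected ∧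
    (ramseyNumber G H : ℤ) =
      ((Nat.card V : ℤ) - 1) * ((H.chromaticNumber.toNat : ℤ) - 1) + (chromaticSurplus H : ℤ)

/-! Lower bound: two disjoint red cliques on n - 1 vertices contain no connected red graph on n
vertices, and the blue graph between them is bipartite, so it has no triangle and no book. Upper
bound: write the number of edges as at most n + l and suppose that a colouring of K_{2n-1} has no
blue book; blue means an edge of `Rᶜ`. Connectedness makes every vertex subset sparse, with excess
at most l. A red copy is built by induction on the number of vertices
(`exists_isEmb_of_bookFreeCompl`). With many leaves, either k of them share a parent or 2k of them
have distinct parents; these are deleted, the rest is embedded, and they are put back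
(`exists_isEmb_of_star`, `exists_isEmb_of_matching`). With a long suspended path, the path is
shortened by one vertex and its red image is lengthened again
(`IsSuspended.exists_isEmb_of_shortcut`). With neither, the graph has few vertices
(`CutConn.card_le_of_no_suspended`) and a greedy argument embeds it
(`SparseOn.exists_isEmb_of_card_le`). Two facts recur. Inside a blue neighbourhood all blue degrees
are below k, so greedy embedding is cheap there. And a set of unused vertices without blue edges is
a red clique, which holds the whole graph once it is large enough. -/

section Embeddings

/-! ### Partial embeddings, cut-connectivity and sparseness -/

open Finset
open scoped Classical

variable {V W : Type*}

/-- The degree of `v` into the finite set `S`. -/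
noncomputable def degIn (G : SimpleGraph V) (S : Finset V) (v : V) : ℕ := #{u ∈ S | G.Adj v u}

/-- The map `f` embeds the part of `G` on the vertex set `S` into the part of `R` on `Z`. -/
structure IsEmb (G : SimpleGraph V) (S : Finset V) (R : SimpleGraph W) (Z : Finset W)
    (f : V → W) : Prop where
  mem : ∀ a ∈ S, f a ∈ Z
  inj : ∀ a ∈ S, ∀ b ∈ S, f a = f b → a = b
  adj : ∀ a ∈ S, ∀ b ∈ S, G.Adj a b → R.Adj (f a) (f b)

/-- The graph `G` restricted to `S` is connected, expressed through cuts. -/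
def CutConn (G : SimpleGraph V) (S : Finset V) : Prop :=
  ∀ T ⊆ S, T.Nonempty → T ≠ S → ∃ a ∈ T, ∃ b ∈ S, b ∉ T ∧ G.Adj a b

/-- Every set `T ⊆ S` spans at most `|T| + l` edges of `G`. -/
def SparseOn (G : SimpleGraph V) (S : Finset V) (l : ℕ) : Prop :=
  ∀ T ⊆ S, ∑ v ∈ T, degIn G T v ≤ 2 * #T + 2 * l

/-- The complement of `R` contains no book with `k` pages. -/
def BookFreeCompl [Fintype W] (R : SimpleGraph W) (k : ℕ) : Prop :=
  ∀ u v, Rᶜ.Adj u v → #{w | Rᶜ.Adj u w ∧ Rᶜ.Adj v w} < k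

lemma degIn_mono (G : SimpleGraph V) {S T : Finset V} (h : S ⊆ T) (v : V) :
    degIn G S v ≤ degIn G T v :=
  card_le_card (filter_subset_filter _ h)

lemma degIn_insert (G : SimpleGraph V) {T : Finset V} {w : V} (hw : w ∉ T) (v : V) :
    degIn G (insert w T) v = degIn G T v + if G.Adj v w then 1 else 0 := by
  unfold degIn
  rw [filter_insert]
  split_ifs with h
  · rw [card_insert_of_notMem (by simp [hw])]
  · simp

lemma degIn_insert_self (G : SimpleGraph V) (T : Finset V) (w : V) :
    degIn G (insert w T) w = degIn G T w := by
  unfold degIn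
  rw [filter_insert]
  simp

lemma degIn_erase_self (G : SimpleGraph V) (T : Finset V) (w : V) :
    degIn G (T.erase w) w = degIn G T w := by
  unfold degIn
  congr 1
  ext u
  simp only [mem_filter, mem_erase]
  exact ⟨fun h => ⟨h.1.2, h.2⟩, fun h => ⟨⟨fun e => by simp [e] at h, h.1⟩, h.2⟩⟩

lemma sum_degIn_insert (G : SimpleGraph V) {T : Finset V} {w : V} (hw : w ∉ T) :
    ∑ v ∈ insert w T, degIn G (insert w T) v = ∑ v ∈ T, degIn G T v + 2 * degIn G T w := by
  rw [sum_insert hw, degIn_insert_self]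
  have : ∑ v ∈ T, degIn G (insert w T) v = ∑ v ∈ T, degIn G T v + degIn G T w := by
    rw [sum_congr rfl fun v _ => degIn_insert G hw v, sum_add_distrib, ← card_filter]
    congr 2
    ext u
    simp [G.adj_comm]
  omega

lemma degIn_lt_card (G : SimpleGraph V) {T : Finset V} {w : V} (hw : w ∈ T) :
    degIn G T w + 1 ≤ #T := by
  rw [← degIn_erase_self, ← card_erase_add_one hw]
  exact Nat.add_le_add_right (card_filter_le _ _) 1

lemma SparseOn.mono {G : SimpleGraph V} {S T : Finset V} {l : ℕ} (h : SparseOn G S l)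
    (hT : T ⊆ S) : SparseOn G T l := fun X hX => h X (hX.trans hT)

/-- Growing T towards S by one vertex adjacent to T at a time adds at least one edge per vertex.
Edges minus vertices therefore never drops on the way up, and the bound for S passes down to T. -/
lemma CutConn.sparseOn {G : SimpleGraph V} {S : Finset V} {l : ℕ} (h : CutConn G S)
    (hs : ∑ v ∈ S, degIn G S v ≤ 2 * #S + 2 * l) : SparseOn G S l := by
  intro T hT
  induction hm : #S - #T generalizing T with
  | zero =>
    have : T = S := eq_of_subset_of_card_le hT (by omega)
    rwa [this]
  | succ m ih =>
    rcases T.eq_empty_or_nonempty with rfl | hne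
    · simp
    have hTS : T ≠ S := by rintro rfl; omega
    obtain ⟨a, ha, b, hb, hbT, hab⟩ := h T hT hne hTS
    have h1 := ih (insert b T) (insert_subset hb hT) (by
      rw [card_insert_of_notMem hbT]; omega)
    rw [sum_degIn_insert G hbT, card_insert_of_notMem hbT] at h1
    have : 0 < degIn G T b := card_pos.2 ⟨a, by simp [ha, hab.symm]⟩
    omega

lemma CutConn.degIn_pos {G : SimpleGraph V} {S : Finset V} (h : CutConn G S) (hS : 2 ≤ #S)
    {v : V} (hv : v ∈ S) : 0 < degIn G S v := by
  obtain ⟨a, ha, b, hb, -, hab⟩ := h {v} (by simpa) (by simp) (by rintro rfl; simp at hS)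
  rw [mem_singleton] at ha
  subst ha
  exact card_pos.2 ⟨b, by simp [hb, hab]⟩

/-- If the only neighbour of w lies in T, the cut of T together with w is used, otherwise the cut of
T; either way the crossing edge avoids w. -/
lemma CutConn.erase {G : SimpleGraph V} {S : Finset V} (h : CutConn G S) {w : V}
    (hd : degIn G S w ≤ 1) : CutConn G (S.erase w) := by
  by_cases hw : w ∈ S
  swap
  · rwa [erase_eq_of_notMem hw]
  intro T hT hne hTS
  have hwT : w ∉ T := fun hh => by simpa using hT hh
  have huniq : ∀ a ∈ S, ∀ b ∈ S, G.Adj w a → G.Adj w b → a = b := fun a ha b hb h1 h2 =>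
    card_le_one.1 hd a (by simp [ha, h1]) b (by simp [hb, h2])
  have hTS' : T ⊆ S := hT.trans (erase_subset _ _)
  by_cases hp : ∃ p ∈ T, G.Adj w p
  · obtain ⟨p, hp, hwp⟩ := hp
    obtain ⟨a, ha, b, hb, hbT, hab⟩ := h (insert w T) (insert_subset hw hTS') (by simp)
      (by rintro rfl; simp [hwT] at hTS)
    rw [mem_insert, not_or] at hbT
    rcases mem_insert.1 ha with rfl | ha
    · exact absurd (huniq p (hTS' hp) b hb hwp hab ▸ hp) hbT.2
    · exact ⟨a, ha, b, by simp [hb, hbT.1], hbT.2, hab⟩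
  · push Not at hp
    obtain ⟨a, ha, b, hb, hbT, hab⟩ := h T hTS' hne (by rintro rfl; exact hwT hw)
    refine ⟨a, ha, b, ?_, hbT, hab⟩
    refine mem_erase.2 ⟨?_, hb⟩
    rintro rfl
    exact hp a ha hab.symm

lemma CutConn.sdiff {G : SimpleGraph V} {S : Finset V} (h : CutConn G S) (X : Finset V)
    (hd : ∀ w ∈ X, degIn G S w ≤ 1) : CutConn G (S \ X) := by
  induction X using Finset.induction_on with
  | empty => simpa
  | insert w X _ ih =>
    have : S \ insert w X = (S \ X).erase w := by ext; simp; tauto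
    rw [this]
    exact (ih fun u hu => hd u (mem_insert_of_mem hu)).erase
      ((degIn_mono G sdiff_subset w).trans (hd w (mem_insert_self _ _)))

lemma IsEmb.mono_right {G : SimpleGraph V} {S : Finset V} {R : SimpleGraph W} {Z Z' : Finset W}
    {f : V → W} (h : IsEmb G S R Z f) (hZ : Z ⊆ Z') : IsEmb G S R Z' f :=
  ⟨fun a ha => hZ (h.mem a ha), h.inj, h.adj⟩

lemma IsEmb.mono_left {G : SimpleGraph V} {S T : Finset V} {R : SimpleGraph W} {Z : Finset W}
    {f : V → W} (h : IsEmb G S R Z f) (hT : T ⊆ S) : IsEmb G T R Z f :=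
  ⟨fun a ha => h.mem a (hT ha), fun a ha b hb => h.inj a (hT ha) b (hT hb),
    fun a ha b hb => h.adj a (hT ha) b (hT hb)⟩

lemma IsEmb.card_image {G : SimpleGraph V} {S : Finset V} {R : SimpleGraph W} {Z : Finset W}
    {f : V → W} (h : IsEmb G S R Z f) : #(S.image f) = #S :=
  card_image_of_injOn fun a ha b hb => h.inj a ha b hb

lemma IsEmb.congr {G : SimpleGraph V} {S : Finset V} {R : SimpleGraph W} {Z : Finset W}
    {f g : V → W} (h : IsEmb G S R Z f) (hfg : ∀ a ∈ S, g a = f a) : IsEmb G S R Z g :=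
  ⟨fun a ha => hfg a ha ▸ h.mem a ha,
    fun a ha b hb e => h.inj a ha b hb (by rw [← hfg a ha, ← hfg b hb, e]),
    fun a ha b hb e => by rw [hfg a ha, hfg b hb]; exact h.adj a ha b hb e⟩

lemma IsEmb.update {G : SimpleGraph V} {T : Finset V} {R : SimpleGraph W} {Z : Finset W}
    {f : V → W} {w : V} (h : IsEmb G (T.erase w) R Z f) {z : W} (hz : z ∈ Z)
    (hzf : z ∉ (T.erase w).image f) (hadj : ∀ a ∈ T.erase w, G.Adj w a → R.Adj z (f a)) :
    IsEmb G T R Z (Function.update f w z) := by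
  have hzf' : ∀ a ∈ T, a ≠ w → f a ≠ z := fun a ha hne e =>
    hzf (mem_image.2 ⟨a, mem_erase.2 ⟨hne, ha⟩, e⟩)
  constructor
  · intro a ha
    by_cases haw : a = w
    · subst haw; simpa
    · simpa [haw] using h.mem a (by simp [haw, ha])
  · intro a ha b hb
    by_cases haw : a = w <;> by_cases hbw : b = w
    · simp [haw, hbw]
    · subst haw; simpa [hbw] using fun e => absurd e.symm (hzf' b hb hbw)
    · subst hbw; simpa [haw] using fun e => absurd e (hzf' a ha haw)
    · simpa [haw, hbw] using h.inj a (by simp [haw, ha]) b (by simp [hbw, hb])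
  · intro a ha b hb hab
    by_cases haw : a = w <;> by_cases hbw : b = w
    · subst haw; subst hbw; simp at hab
    · subst haw; simpa [hbw] using hadj b (by simp [hbw, hb]) hab
    · subst hbw; simpa [haw] using (hadj a (by simp [haw, ha]) hab.symm).symm
    · simpa [haw, hbw] using h.adj a (by simp [haw, ha]) b (by simp [hbw, hb]) hab

/-- An embedding of `Q` extends to `S` if every intermediate set has a vertex, outside `Q`, that
can always be put back. -/
lemma IsEmb.extend {G : SimpleGraph V} {Q S : Finset V} {R : SimpleGraph W} {Z : Finset W}
    {f₀ : V → W} (h₀ : IsEmb G Q R Z f₀) (hQS : Q ⊆ S)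
    (step : ∀ T ⊆ S, Q ⊂ T → ∃ w ∈ T, w ∉ Q ∧ ∀ f, IsEmb G (T.erase w) R Z f →
      (∀ a ∈ Q, f a = f₀ a) → ∃ z ∈ Z, z ∉ (T.erase w).image f ∧
        ∀ a ∈ T.erase w, G.Adj w a → R.Adj z (f a)) :
    ∃ f, IsEmb G S R Z f ∧ ∀ a ∈ Q, f a = f₀ a := by
  suffices H : ∀ m, ∀ T ⊆ S, Q ⊆ T → #T = m → ∃ f, IsEmb G T R Z f ∧ ∀ a ∈ Q, f a = f₀ a from
    H _ S subset_rfl hQS rfl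
  intro m
  induction m using Nat.strong_induction_on with
  | _ m ih =>
    intro T hTS hQT hm
    rcases eq_or_ne Q T with rfl | hne
    · exact ⟨f₀, h₀, fun _ _ => rfl⟩
    obtain ⟨w, hwT, hwQ, hw⟩ := step T hTS (hQT.ssubset_of_ne hne)
    obtain ⟨f, hf, hfQ⟩ := ih _ (by rw [← hm, card_erase_of_mem hwT]
                                    have := card_pos.2 ⟨w, hwT⟩
                                    omega)
      (T.erase w) ((erase_subset _ _).trans hTS)
      (fun a ha => mem_erase.2 ⟨fun e => hwQ (e ▸ ha), hQT ha⟩) rfl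
    obtain ⟨z, hzZ, hzf, hz⟩ := hw f hf hfQ
    refine ⟨_, hf.update hzZ hzf hz, fun a ha => ?_⟩
    have haw : a ≠ w := by rintro rfl; exact hwQ ha
    rw [Function.update_of_ne haw, hfQ a ha]

/-- In a set where all degrees of the complement of `R` are less than `k`, greedy embedding. -/
lemma IsEmb.extend_greedy {G : SimpleGraph V} {Q S : Finset V} {R : SimpleGraph W}
    {Z : Finset W} {f₀ : V → W} {k : ℕ} (h₀ : IsEmb G Q R Z f₀) (hQS : Q ⊆ S)
    (hZ : ∀ z ∈ Z, #{y ∈ Z | Rᶜ.Adj z y} ≤ k)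
    (step : ∀ T ⊆ S, Q ⊂ T → ∃ w ∈ T, w ∉ Q ∧ #T + degIn G T w * k ≤ #Z) :
    ∃ f, IsEmb G S R Z f ∧ ∀ a ∈ Q, f a = f₀ a := by
  refine h₀.extend hQS fun T hTS hQT => ?_
  obtain ⟨w, hwT, hwQ, hle⟩ := step T hTS hQT
  refine ⟨w, hwT, hwQ, fun f hf _ => ?_⟩
  set N := {u ∈ T.erase w | G.Adj w u}
  have hN : #N = degIn G T w := degIn_erase_self G T w
  -- Forbidden images for w: the vertices already used, and the blue neighbours in Z of the images
  -- of its neighbours, at most k for each of them.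
  set bad := (T.erase w).image f ∪ N.biUnion fun a => {y ∈ Z | Rᶜ.Adj (f a) y}
  have hbad : #bad < #Z := by
    have h1 : #((T.erase w).image f) + 1 = #T := by
      rw [hf.card_image, card_erase_add_one hwT]
    have h2 : #(N.biUnion fun a => {y ∈ Z | Rᶜ.Adj (f a) y}) ≤ #N * k :=
      card_biUnion_le_card_mul _ _ _ fun a ha => hZ _ (hf.mem a (mem_filter.1 ha).1)
    have h3 : #bad ≤ _ := card_union_le ((T.erase w).image f)
      (N.biUnion fun a => {y ∈ Z | Rᶜ.Adj (f a) y})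
    rw [hN] at h2
    omega
  obtain ⟨z, hzZ, hzb⟩ := exists_mem_notMem_of_card_lt_card hbad
  simp only [bad, mem_union, not_or] at hzb
  refine ⟨z, hzZ, hzb.1, fun a ha hwa => ?_⟩
  by_contra hcon
  refine hzb.2 (mem_biUnion.2 ⟨a, by simp only [N, mem_filter]; exact ⟨ha, hwa⟩, ?_⟩)
  simp only [mem_filter, hzZ, true_and, SimpleGraph.compl_adj]
  exact ⟨fun e => hzb.1 (e ▸ mem_image_of_mem f ha), fun e => hcon e.symm⟩

lemma isEmb_empty (G : SimpleGraph V) (R : SimpleGraph W) (Z : Finset W) (f : V → W) :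
    IsEmb G ∅ R Z f := ⟨by simp, by simp, by simp⟩

lemma isEmb_singleton (G : SimpleGraph V) (R : SimpleGraph W) {Z : Finset W} (v : V) {z : W}
    (hz : z ∈ Z) : IsEmb G {v} R Z fun _ => z :=
  ⟨by simpa, by simp, by simp⟩

lemma exists_isEmb_of_clique [Nonempty W] (G : SimpleGraph V) (S : Finset V)
    {R : SimpleGraph W} {Z : Finset W} (hZ : ∀ y ∈ Z, ∀ z ∈ Z, ¬ Rᶜ.Adj y z)
    (hcard : #S ≤ #Z) : ∃ f, IsEmb G S R Z f := by
  obtain ⟨f, hf, -⟩ := (isEmb_empty G R Z fun _ => Classical.arbitrary W).extend_greedy (k := 0)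
    (empty_subset S)
    (fun z hz => by
      rw [Nat.le_zero, card_eq_zero, filter_eq_empty_iff]
      exact fun y hy => hZ z hz y hy)
    (fun T hTS hT => by
      obtain ⟨w, hw⟩ := empty_ssubset.1 hT
      exact ⟨w, hw, by simp, by simpa using (card_le_card hTS).trans hcard⟩)
  exact ⟨f, hf⟩

end Embeddings

/-! ### Shortening and lengthening suspended paths -/

section SuspendedPaths

open Finset
open scoped Classical

variable {V W : Type*}

/-- `p 0, …, p m` is a path of `G`. -/
structure IsPathSeq (G : SimpleGraph V) (m : ℕ) (p : ℕ → V) : Prop where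
  inj : ∀ s ≤ m, ∀ t ≤ m, p s = p t → s = t
  adj : ∀ t < m, G.Adj (p t) (p (t + 1))

/-- The longer path is p 0, …, p i, y, p j, p (j-1), …, p (i+1), p (j+1), …, p m: the segment
between the two attachments is reversed. For j = i + 1 that segment is a single vertex, and y is
simply inserted. -/
lemma IsPathSeq.exists_longer {R : SimpleGraph W} {m : ℕ} {p : ℕ → W} (hp : IsPathSeq R m p)
    {y : W} (hy : ∀ t ≤ m, p t ≠ y) {i j : ℕ} (hij : i < j) (hj : j ≤ m)
    (hyi : R.Adj y (p i)) (hyj : R.Adj y (p j))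
    (h : j = i + 1 ∨ (j + 1 ≤ m ∧ R.Adj (p (i + 1)) (p (j + 1)))) :
    ∃ q, IsPathSeq R (m + 1) q ∧ q 0 = p 0 ∧ q (m + 1) = p m ∧
      ∀ t ≤ m + 1, q t = y ∨ ∃ s ≤ m, q t = p s := by
  refine ⟨fun t => if t ≤ i then p t else if t = i + 1 then y else
    if t ≤ j + 1 then p (j + i + 2 - t) else p (t - 1), ⟨?_, ?_⟩, ?_, ?_, ?_⟩
  · intro s hs t ht hst
    split_ifs at hst <;>
    first
      | omega
      | (have := hp.inj _ (by omega) _ (by omega) hst; omega)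
      | exact absurd hst (hy _ (by omega))
      | exact absurd hst.symm (hy _ (by omega))
  · intro t ht
    rcases lt_trichotomy t i with h1 | rfl | h1
    · rw [if_pos h1.le, if_pos (by omega)]
      exact hp.adj t (by omega)
    · rw [if_pos le_rfl, if_neg (by omega), if_pos rfl]
      exact hyi.symm
    rw [if_neg (by omega), if_neg (by omega : ¬ t + 1 ≤ i), if_neg (by omega : ¬ t + 1 = i + 1)]
    by_cases h2 : t = i + 1
    · subst h2
      rw [if_pos rfl, if_pos (by omega)]
      convert hyj using 2
      omega
    rw [if_neg h2]
    by_cases h3 : t + 1 ≤ j + 1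
    · rw [if_pos (by omega), if_pos h3]
      convert (hp.adj (j + i + 2 - (t + 1)) (by omega)).symm using 2
      omega
    rw [if_neg h3]
    by_cases h4 : t = j + 1
    · subst h4
      rw [if_pos le_rfl]
      rcases h with rfl | h
      · convert hp.adj (i + 1) (by omega) using 2 <;> omega
      · convert h.2 using 2 <;> omega
    · rw [if_neg (by omega)]
      convert hp.adj (t - 1) (by omega) using 2
      omega
  · simp
  · dsimp only
    rw [if_neg (by omega), if_neg (by omega)]
    split_ifs
    · congr 1
      omega
    · simp
  · intro t ht
    dsimp only
    split_ifs
    · exact Or.inr ⟨_, by omega, rfl⟩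
    · exact Or.inl rfl
    · exact Or.inr ⟨_, by omega, rfl⟩
    · exact Or.inr ⟨_, by omega, rfl⟩

/-- `x 0, …, x m` is a path of `G` inside `S`, all of whose vertices have degree two in `S`. -/
structure IsSuspended (G : SimpleGraph V) (S : Finset V) (m : ℕ) (x : ℕ → V) : Prop extends
    IsPathSeq G m x where
  mem : ∀ t ≤ m, x t ∈ S
  deg : ∀ t ≤ m, degIn G S (x t) = 2

lemma eq_or_eq_of_degIn_eq_two {G : SimpleGraph V} {S : Finset V} {v a b c : V}
    (hd : degIn G S v = 2) (ha : a ∈ S) (hb : b ∈ S) (hab : a ≠ b) (hva : G.Adj v a)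
    (hvb : G.Adj v b) (hc : c ∈ S) (hvc : G.Adj v c) : c = a ∨ c = b := by
  have : ({a, b} : Finset V) = {u ∈ S | G.Adj v u} := by
    refine eq_of_subset_of_card_le ?_ ?_
    · intro u hu
      simp only [mem_insert, mem_singleton] at hu
      rcases hu with rfl | rfl <;> simp [*]
    · rw [card_pair hab]; exact hd.le
  have hc' : c ∈ ({a, b} : Finset V) := by rw [this]; simp [hc, hvc]
  simpa using hc'

lemma IsSuspended.eq_of_adj {G : SimpleGraph V} {S : Finset V} {m : ℕ} {x : ℕ → V}
    (hx : IsSuspended G S m x) {t : ℕ} (ht : t + 2 ≤ m) {c : V} (hc : c ∈ S)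
    (h : G.Adj (x (t + 1)) c) : c = x t ∨ c = x (t + 2) := by
  refine eq_or_eq_of_degIn_eq_two (hx.deg (t + 1) (by omega)) (hx.mem t (by omega))
    (hx.mem (t + 2) ht) (fun e => ?_) (hx.adj t (by omega)).symm (hx.adj (t + 1) (by omega)) hc h
  have := hx.inj _ (by omega) _ (by omega) e
  omega

/-- The graph obtained from `G` by joining `x 0` to `x 2`, so that on `S.erase (x 1)` the path `x`
is shortened by one vertex. -/
def shortcut (G : SimpleGraph V) (x : ℕ → V) : SimpleGraph V :=
  G ⊔ SimpleGraph.edge (x 0) (x 2)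

/-- The vertex x 1 is put on the same side as x 0. A crossing edge of G at x 1 can then only be the
one to x 2, and the new edge replaces it. -/
lemma IsSuspended.cutConn_shortcut {G : SimpleGraph V} {S : Finset V} {m : ℕ} {x : ℕ → V}
    (hx : IsSuspended G S m x) (hm : 2 ≤ m) (hS : CutConn G S) :
    CutConn (shortcut G x) (S.erase (x 1)) := by
  have h02 : x 0 ≠ x 2 := fun e => by have := hx.inj _ (by omega) _ (by omega) e; omega
  have h12 : x 2 ≠ x 1 := fun e => by have := hx.inj _ (by omega) _ (by omega) e; omega
  have h01 : x 0 ≠ x 1 := fun e => by have := hx.inj _ (by omega) _ (by omega) e; omega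
  have hedge : (shortcut G x).Adj (x 0) (x 2) := by
    simp [shortcut, SimpleGraph.edge_adj, h02]
  have hle : G ≤ shortcut G x := le_sup_left
  intro T hT hne hTS
  have h1T : x 1 ∉ T := fun hh => by simpa using hT hh
  have hTS' : T ⊆ S := hT.trans (erase_subset _ _)
  by_cases h0 : x 0 ∈ T
  · obtain ⟨a, ha, b, hb, hbT, hab⟩ := hS (insert (x 1) T)
      (insert_subset (hx.mem 1 (by omega)) hTS') (by simp)
      (by intro e; rw [← e] at hTS; simp [h1T] at hTS)
    rw [mem_insert, not_or] at hbT
    rcases mem_insert.1 ha with rfl | ha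
    · rcases hx.eq_of_adj (t := 0) (by omega) hb hab with rfl | rfl
      · exact absurd h0 hbT.2
      · exact ⟨x 0, h0, x 2, by simp [hb, h12], hbT.2, hedge⟩
    · exact ⟨a, ha, b, by simp [hb, hbT.1], hbT.2, hle hab⟩
  · obtain ⟨a, ha, b, hb, hbT, hab⟩ := hS T hTS' hne
      (by rintro rfl; exact h1T (hx.mem 1 (by omega)))
    by_cases hb1 : b = x 1
    · subst hb1
      rcases hx.eq_of_adj (t := 0) (by omega) (hTS' ha) hab.symm with rfl | rfl
      · exact absurd ha h0
      · exact ⟨x 2, ha, x 0, by simp [h01, hx.mem 0 (by omega)], h0, hedge.symm⟩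
    · exact ⟨a, ha, b, by simp [hb, hb1], hbT, hle hab⟩

lemma degIn_shortcut_le (G : SimpleGraph V) (T : Finset V) (x : ℕ → V) (v : V) :
    degIn (shortcut G x) T v ≤ degIn G T v + ((if v = x 0 ∧ x 2 ∈ T then 1 else 0) +
      if v = x 2 ∧ x 0 ∈ T then 1 else 0) := by
  have : ({u ∈ T | (shortcut G x).Adj v u} : Finset V) ⊆ {u ∈ T | G.Adj v u} ∪
      ((if v = x 0 ∧ x 2 ∈ T then {x 2} else ∅) ∪ if v = x 2 ∧ x 0 ∈ T then {x 0} else ∅) := by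
    intro u hu
    simp only [shortcut, mem_filter, SimpleGraph.sup_adj, SimpleGraph.edge_adj] at hu
    rcases hu with ⟨hu, h | ⟨⟨rfl, rfl⟩ | ⟨rfl, rfl⟩, -⟩⟩
    · simp [hu, h]
    · simp [hu]
    · simp [hu]
  refine (card_le_card this).trans ((card_union_le _ _).trans (add_le_add le_rfl
    ((card_union_le _ _).trans (add_le_add ?_ ?_)))) <;> split_ifs <;> simp

/-- The new edge matters only if T contains both its ends. Then adding x 1 to T costs one vertex but
at least two edges of G, which pays for the new edge. -/
lemma IsSuspended.sparseOn_shortcut {G : SimpleGraph V} {S : Finset V} {m l : ℕ} {x : ℕ → V}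
    (hx : IsSuspended G S m x) (hm : 2 ≤ m) (hS : SparseOn G S l) :
    SparseOn (shortcut G x) (S.erase (x 1)) l := by
  intro T hT
  have h1T : x 1 ∉ T := fun hh => by simpa using hT hh
  have hTS' : T ⊆ S := hT.trans (erase_subset _ _)
  have h02 : x 0 ≠ x 2 := fun e => by have := hx.inj _ (by omega) _ (by omega) e; omega
  have hsum := sum_le_sum fun v (_ : v ∈ T) => degIn_shortcut_le G T x v
  rw [sum_add_distrib, sum_add_distrib] at hsum
  by_cases h : x 0 ∈ T ∧ x 2 ∈ T
  · simp only [h.1, h.2, and_true, sum_ite_eq', if_true] at hsum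
    have h1 := hS (insert (x 1) T) (insert_subset (hx.mem 1 (by omega)) hTS')
    rw [sum_degIn_insert G h1T, card_insert_of_notMem h1T] at h1
    have h2 : 2 ≤ degIn G T (x 1) := by
      rw [← card_pair h02]
      refine card_le_card fun u hu => ?_
      simp only [mem_insert, mem_singleton] at hu
      rcases hu with rfl | rfl
      · simpa [h.1] using (hx.adj 0 (by omega)).symm
      · simpa [h.2] using hx.adj 1 (by omega)
    omega
  · have h1 : ∑ v ∈ T, (if v = x 0 ∧ x 2 ∈ T then 1 else 0) = 0 :=
      
      sum_eq_zero fun v hv => by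
        rw [if_neg]
        rintro ⟨rfl, h'⟩
        exact h ⟨hv, h'⟩
    have h2 : ∑ v ∈ T, (if v = x 2 ∧ x 0 ∈ T then 1 else 0) = 0 :=
      
      sum_eq_zero fun v hv => by
        rw [if_neg]
        rintro ⟨rfl, h'⟩
        exact h ⟨h', hv⟩
    have := hS T hTS'
    omega

/-- An embedding of the complement of the interior of a suspended path extends along a path with
the right ends. -/
lemma IsSuspended.exists_isEmb {G : SimpleGraph V} {S : Finset V} {R : SimpleGraph W}
    {Z : Finset W} {m : ℕ} {x : ℕ → V} (hx : IsSuspended G S m x) {f : V → W}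
    (hf : IsEmb G {v ∈ S | ∀ t, 0 < t → t < m → x t ≠ v} R Z f) {q : ℕ → W}
    (hq : IsPathSeq R m q) (hqZ : ∀ t ≤ m, q t ∈ Z) (h0 : q 0 = f (x 0)) (hm : q m = f (x m))
    (hqf : ∀ t, 0 < t → t < m → ∀ v ∈ S, (∀ t, 0 < t → t < m → x t ≠ v) → q t ≠ f v) :
    ∃ g, IsEmb G S R Z g := by
  let g : V → W := fun v => if h : ∃ t, (0 < t ∧ t < m) ∧ x t = v then q h.choose else f v
  have hgx : ∀ t ≤ m, g (x t) = q t := by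
    intro t ht
    by_cases h : ∃ s, (0 < s ∧ s < m) ∧ x s = x t
    · have h1 := h.choose_spec
      simp only [g, dif_pos h]
      rw [hx.inj _ (by omega) _ ht h1.2]
    · simp only [g, dif_neg h]
      have : t = 0 ∨ t = m := by
        by_contra hcon
        exact h ⟨t, by omega, rfl⟩
      rcases this with rfl | rfl
      · exact h0.symm
      · exact hm.symm
  have hgf : ∀ v, (∀ t, 0 < t → t < m → x t ≠ v) → g v = f v := by
    intro v hv
    have h : ¬ ∃ t, (0 < t ∧ t < m) ∧ x t = v := by
      rintro ⟨t, ⟨h1, h2⟩, h3⟩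
      exact hv t h1 h2 h3
    simp only [g, dif_neg h]
  have hint : ∀ v, (∃ t, 0 < t ∧ t < m ∧ x t = v) ∨ ∀ t, 0 < t → t < m → x t ≠ v := by
    intro v
    by_cases h : ∃ t, 0 < t ∧ t < m ∧ x t = v
    · exact Or.inl h
    · push Not at h; exact Or.inr h
  have hadj : ∀ t, 0 < t → t < m → ∀ b ∈ S, G.Adj (x t) b → R.Adj (g (x t)) (g b) := by
    intro t h1 h2 b hb hab
    obtain ⟨t, rfl⟩ := Nat.exists_eq_succ_of_ne_zero h1.ne'
    rcases hx.eq_of_adj (t := t) (by omega) hb hab with rfl | rfl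
    · rw [hgx _ (by omega), hgx _ (by omega)]
      exact (hq.adj t (by omega)).symm
    · rw [hgx _ (by omega), hgx _ (by omega)]
      exact hq.adj (t + 1) (by omega)
  refine ⟨g, ?_, ?_, ?_⟩
  · intro a ha
    rcases hint a with ⟨t, -, ht, rfl⟩ | h
    · rw [hgx t ht.le]; exact hqZ t ht.le
    · rw [hgf a h]; exact hf.mem a (by simpa [ha] using h)
  · intro a ha b hb hab
    rcases hint a with ⟨t, ht0, ht, rfl⟩ | h <;> rcases hint b with ⟨s, hs0, hs, rfl⟩ | h'
    · rw [hgx t ht.le, hgx s hs.le] at hab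
      rw [hq.inj _ ht.le _ hs.le hab]
    · rw [hgx t ht.le, hgf b h'] at hab
      exact absurd hab (hqf t ht0 ht b hb h')
    · rw [hgx s hs.le, hgf a h] at hab
      exact absurd hab.symm (hqf s hs0 hs a ha h)
    · rw [hgf a h, hgf b h'] at hab
      exact hf.inj a (by simpa [ha] using h) b (by simpa [hb] using h') hab
  · intro a ha b hb hab
    rcases hint a with ⟨t, ht0, ht, rfl⟩ | h
    · exact hadj t ht0 ht b hb hab
    rcases hint b with ⟨s, hs0, hs, rfl⟩ | h'
    · exact (hadj s hs0 hs a ha hab.symm).symm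
    · rw [hgf a h, hgf b h']
      exact hf.adj a (by simpa [ha] using h) b (by simpa [hb] using h') hab

/-- In a blue clique on k + 2 vertices any edge is the spine of a book whose pages are the other k
vertices. -/
lemma BookFreeCompl.card_clique_lt [Fintype W] {R : SimpleGraph W} {k : ℕ}
    (hR : BookFreeCompl R k) {C : Finset W} (hC : ∀ y ∈ C, ∀ z ∈ C, y ≠ z → Rᶜ.Adj y z) :
    #C < k + 2 := by
  by_contra! hcon
  obtain ⟨u, hu, v, hv, huv⟩ := one_lt_card.1 (by omega : 1 < #C)
  have h1 : (C.erase u).erase v ⊆ ({w | Rᶜ.Adj u w ∧ Rᶜ.Adj v w} : Finset W) := by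
    intro w hw
    simp only [mem_erase] at hw
    simp only [mem_filter, mem_univ, true_and]
    exact ⟨hC u hu w hw.2.2 (Ne.symm hw.2.1), hC v hv w hw.2.2 (Ne.symm hw.1)⟩
  have h2 := card_le_card h1
  rw [card_erase_of_mem (by simp [hv, huv.symm]), card_erase_of_mem hu] at h2
  have := hR u v (hC u hu v hv huv)
  omega

/-- The shortened path has a red image p 0, …, p (3k). If no unused vertex can be absorbed by
rerouting, then for each unused y the successors of its red neighbours on the path form with y a
blue clique, so y has at most k red neighbours among 3k path vertices. Two unused vertices joined in
blue would then share k blue neighbours on the path, a blue book. So the unused vertices form a red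
clique, with room for all of S. -/
lemma IsSuspended.exists_isEmb_of_shortcut [Fintype W] [Nonempty W] {G : SimpleGraph V}
    {S : Finset V} {R : SimpleGraph W} {k : ℕ} {x : ℕ → V} (hR : BookFreeCompl R k)
    (hk : 1 ≤ k) (hx : IsSuspended G S (3 * k + 1) x) (hS : 2 * #S ≤ Fintype.card W + 1) {f : V → W}
    (hf : IsEmb (shortcut G x) (S.erase (x 1)) R univ f) : ∃ g, IsEmb G S R univ g := by
  by_contra hcon
  have h02 : x 0 ≠ x 2 := fun e => by have := hx.inj _ (by omega) _ (by omega) e; omega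
  have hne1 : ∀ t ≤ 3 * k + 1, t ≠ 1 → x t ∈ S.erase (x 1) := fun t ht h1 =>
    mem_erase.2 ⟨fun e => h1 (hx.inj t ht 1 (by omega) e), hx.mem t ht⟩
  have hGle : G ≤ shortcut G x := le_sup_left
  -- Reindexes the path so that it jumps over x 1.
  let e : ℕ → ℕ := fun t => if t = 0 then 0 else t + 1
  have he : ∀ t ≤ 3 * k, e t ≤ 3 * k + 1 ∧ e t ≠ 1 := by
    intro t ht; simp only [e]; split_ifs <;> omega
  have hei : ∀ s t, e s = e t → s = t := by
    intro s t h; simp only [e] at h; split_ifs at h <;> omega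
  set p : ℕ → W := fun t => f (x (e t)) with hpdef
  have hp : IsPathSeq R (3 * k) p := by
    constructor
    · intro s hs t ht hst
      exact hei s t (hx.inj _ (he s hs).1 _ (he t ht).1
        (hf.inj _ (hne1 _ (he s hs).1 (he s hs).2) _ (hne1 _ (he t ht).1 (he t ht).2) hst))
    · intro t ht
      refine hf.adj _ (hne1 _ (he t ht.le).1 (he t ht.le).2) _
        (hne1 _ (he (t + 1) ht).1 (he (t + 1) ht).2) ?_
      by_cases h0 : t = 0
      · subst h0
        simp [e, shortcut, SimpleGraph.edge_adj, h02]
      · simp only [e, if_neg h0, if_neg (Nat.succ_ne_zero t)]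
        exact hGle (hx.adj (t + 1) (by omega))
  set Y : Finset W := univ \ (S.erase (x 1)).image f with hY
  have hpY : ∀ y ∈ Y, ∀ t ≤ 3 * k, p t ≠ y := by
    rintro y hy t ht rfl
    simp only [hY, mem_sdiff, mem_univ, true_and] at hy
    exact hy (mem_image_of_mem f (hne1 _ (he t ht).1 (he t ht).2))
  have hno : ∀ y ∈ Y, ∀ i j, i < j → j ≤ 3 * k → R.Adj y (p i) → R.Adj y (p j) →
      ¬ (j = i + 1 ∨ (j + 1 ≤ 3 * k ∧ R.Adj (p (i + 1)) (p (j + 1)))) := by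
    intro y hy i j hij hj hyi hyj h
    obtain ⟨q, hq, hq0, hqm, hqy⟩ := hp.exists_longer (hpY y hy) hij hj hyi hyj h
    refine hcon (hx.exists_isEmb (f := f) (q := q) ?_ hq (fun _ _ => mem_univ _) ?_ ?_ ?_)
    · have hsub : ({v ∈ S | ∀ t, 0 < t → t < 3 * k + 1 → x t ≠ v} : Finset V) ⊆
          S.erase (x 1) := by
        intro v hv
        rw [mem_filter] at hv
        exact mem_erase.2 ⟨(hv.2 1 (by omega) (by omega)).symm, hv.1⟩
      have := hf.mono_left hsub
      exact ⟨this.mem, this.inj, fun a ha b hb hab => this.adj a ha b hb (hGle hab)⟩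
    · rw [hq0]; simp [hpdef, e]
    · rw [hqm]; simp only [hpdef, e]; rw [if_neg (by omega)]
    · intro t ht0 ht v hv hvx hqv
      have hv1 : v ∈ S.erase (x 1) := mem_erase.2 ⟨(hvx 1 (by omega) (by omega)).symm, hv⟩
      rcases hqy t (by omega) with h1 | ⟨s, hs, h1⟩
      · rw [h1] at hqv
        subst hqv
        simp only [hY, mem_sdiff, mem_univ, true_and] at hy
        exact hy (mem_image_of_mem f hv1)
      · rw [h1] at hqv
        have h2 := hf.inj _ (hne1 _ (he s hs).1 (he s hs).2) _ hv1 hqv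
        have h3 : s = 0 ∨ s = 3 * k := by
          by_contra hcc
          refine hvx (e s) ?_ ?_ h2 <;> simp only [e] <;> split_ifs <;> omega
        rcases h3 with rfl | rfl
        · have := hq.inj t (by omega) 0 (by omega) (by rw [h1, hq0])
          omega
        · have := hq.inj t (by omega) (3 * k + 1) (by omega) (by rw [h1, hqm])
          omega
  -- The last vertex p (3k) is left out so that every index counted has a successor on the path.
  have hI : ∀ y ∈ Y, #{i ∈ range (3 * k) | R.Adj y (p i)} ≤ k := by
    intro y hy
    set I := {i ∈ range (3 * k) | R.Adj y (p i)}
    have hIm : ∀ i ∈ I, i < 3 * k ∧ R.Adj y (p i) := fun i hi => by simpa [I] using hi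
    have hyI : y ∉ I.image fun i => p (i + 1) := by
      intro h
      obtain ⟨i, hi, h⟩ := mem_image.1 h
      exact hpY y hy (i + 1) (hIm i hi).1 h
    have hyb : ∀ i ∈ I, Rᶜ.Adj y (p (i + 1)) := by
      intro i hi
      rw [SimpleGraph.compl_adj]
      exact ⟨(hpY y hy _ (hIm i hi).1).symm, fun h =>
        hno y hy i (i + 1) (by omega) (hIm i hi).1 (hIm i hi).2 h (Or.inl rfl)⟩
    have hpb : ∀ i ∈ I, ∀ j ∈ I, i < j → Rᶜ.Adj (p (i + 1)) (p (j + 1)) := by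
      intro i hi j hj hij
      rw [SimpleGraph.compl_adj]
      refine ⟨fun h => ?_, fun h => hno y hy i j hij (hIm j hj).1.le (hIm i hi).2 (hIm j hj).2
        (Or.inr ⟨(hIm j hj).1, h⟩)⟩
      have := hp.inj _ (hIm i hi).1 _ (hIm j hj).1 h
      omega
    have h1 := hR.card_clique_lt (C := insert y (I.image fun i => p (i + 1))) (by
      intro a ha b hb hab
      simp only [mem_insert, mem_image] at ha hb
      rcases ha with rfl | ⟨i, hi, rfl⟩ <;> rcases hb with rfl | ⟨j, hj, rfl⟩
      · exact absurd rfl hab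
      · exact hyb j hj
      · exact (hyb i hi).symm
      · rcases lt_trichotomy i j with h | rfl | h
        · exact hpb i hi j hj h
        · exact absurd rfl hab
        · exact (hpb j hj i hi h).symm)
    rw [card_insert_of_notMem hyI, card_image_of_injOn] at h1
    · omega
    · intro i hi j hj h
      have := hp.inj _ (hIm i hi).1 _ (hIm j hj).1 h
      omega
  refine hcon (exists_isEmb_of_clique G S (Z := Y) ?_ ?_ |>.imp fun g hg =>
    hg.mono_right (subset_univ _))
  · intro y hy z hz hyz
    have h1 := hR y z hyz
    have h2 : (range (3 * k) \ ({i ∈ range (3 * k) | R.Adj y (p i)} ∪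
        {i ∈ range (3 * k) | R.Adj z (p i)})).image p ⊆ ({w | Rᶜ.Adj y w ∧ Rᶜ.Adj z w} : Finset W) := by
      intro w hw
      obtain ⟨i, hi, rfl⟩ := mem_image.1 hw
      simp only [mem_sdiff, mem_range, mem_union, mem_filter, not_or, not_and] at hi
      simp only [mem_filter, mem_univ, true_and, SimpleGraph.compl_adj]
      exact ⟨⟨(hpY y hy i (by omega)).symm, hi.2.1 hi.1⟩, (hpY z hz i (by omega)).symm,
        hi.2.2 hi.1⟩
    have h3 := card_le_card h2
    rw [card_image_of_injOn] at h3
    · have h4 := le_card_sdiff ({i ∈ range (3 * k) | R.Adj y (p i)} ∪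
        {i ∈ range (3 * k) | R.Adj z (p i)}) (range (3 * k))
      have h5 := card_union_le {i ∈ range (3 * k) | R.Adj y (p i)}
        {i ∈ range (3 * k) | R.Adj z (p i)}
      have := hI y hy
      have := hI z hz
      rw [card_range] at h4
      omega
    · intro i hi j hj h
      simp only [coe_sdiff, Set.mem_sdiff, mem_coe, mem_range] at hi hj
      exact hp.inj i hi.1.le j hj.1.le h
  · rw [hY, card_sdiff_of_subset (subset_univ _), hf.card_image,
      card_erase_of_mem (hx.mem 1 (by omega)), card_univ]
    have := card_pos.2 ⟨_, hx.mem 1 (by omega)⟩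
    omega

end SuspendedPaths

/-! ### Greedy embeddings of sparse graphs -/

section Greedy

open Finset
open scoped Classical

variable {V W : Type*}

lemma exists_degIn_mul_card_le (G : SimpleGraph V) {T : Finset V} (hT : T.Nonempty) :
    ∃ w ∈ T, degIn G T w * #T ≤ ∑ v ∈ T, degIn G T v := by
  obtain ⟨w, hw, hmin⟩ := exists_min_image T (degIn G T) hT
  refine ⟨w, hw, ?_⟩
  have := card_nsmul_le_sum T (degIn G T) (degIn G T w) hmin
  rwa [smul_eq_mul, mul_comm] at this

/-- The blue neighbours of z in Z are pages on the blue edge xz. -/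
lemma BookFreeCompl.card_filter_le [Fintype W] {R : SimpleGraph W} {k : ℕ}
    (hR : BookFreeCompl R k) {x : W} {Z : Finset W} (hZ : ∀ z ∈ Z, Rᶜ.Adj x z) :
    ∀ z ∈ Z, #{y ∈ Z | Rᶜ.Adj z y} ≤ k - 1 := by
  intro z hz
  have h1 := hR x z (hZ z hz)
  have h2 : ({y ∈ Z | Rᶜ.Adj z y} : Finset W) ⊆ ({w | Rᶜ.Adj x w ∧ Rᶜ.Adj z w} : Finset W) := by
    intro y hy
    rw [mem_filter] at hy
    simp only [mem_filter, mem_univ, true_and]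
    exact ⟨hZ y hy.1, hy.2⟩
  have := card_le_card h2
  omega

/-- A set T with more than 2l + 3 vertices has a vertex other than v of degree at most two, since
degrees of at least three off v would contradict sparseness. Smaller sets need no choice: the
trivial bound #T - 1 on the degree suffices. -/
lemma SparseOn.exists_isEmb_pinned {G : SimpleGraph V} {S : Finset V} {l : ℕ}
    (hS : SparseOn G S l) {R : SimpleGraph W} {Z : Finset W} {k : ℕ}
    (hZ : ∀ z ∈ Z, #{y ∈ Z | Rᶜ.Adj z y} ≤ k - 1) (hk : 1 ≤ k)
    (h1 : #S + 2 * (k - 1) ≤ #Z) (h2 : (2 * l + 3) * k ≤ #Z) {v : V} (hv : v ∈ S) {z : W}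
    (hz : z ∈ Z) : ∃ f, IsEmb G S R Z f ∧ f v = z := by
  obtain ⟨f, hf, hfv⟩ := (isEmb_singleton G R v hz).extend_greedy (S := S) (by simpa) hZ (by
    intro T hTS hvT
    have hvT' : v ∈ T := hvT.1 (mem_singleton_self v)
    by_cases hT : #T ≤ 2 * l + 3
    · obtain ⟨w, hwT, hwv⟩ := exists_of_ssubset hvT
      refine ⟨w, hwT, hwv, le_trans ?_ h2⟩
      have h3 := degIn_lt_card G hwT
      obtain ⟨k, rfl⟩ := Nat.exists_eq_add_of_le' hk
      rw [Nat.add_sub_cancel]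
      nlinarith
    · have : ∃ w ∈ T.erase v, degIn G T w ≤ 2 := by
        by_contra! hcon
        have h3 : #(T.erase v) • 3 ≤ ∑ u ∈ T.erase v, degIn G T u :=
          card_nsmul_le_sum _ _ 3 hcon
        have h4 := sum_le_sum_of_subset (f := degIn G T) (erase_subset v T)
        have h5 := hS T hTS
        rw [card_erase_of_mem hvT', smul_eq_mul] at h3
        omega
      obtain ⟨w, hw, hd⟩ := this
      rw [mem_erase] at hw
      refine ⟨w, hw.2, by simpa using hw.1, ?_⟩
      have h3 := card_le_card hTS
      have h4 := Nat.mul_le_mul_right (k - 1) hd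
      omega)
  exact ⟨f, hf, hfv v (mem_singleton_self v)⟩

/-- The minimum degree e of T satisfies e * #T ≤ 2 * #T + 2 * l and #T ≥ e + 1, whence (e - 2)(e +
1) ≤ 2l. So d bounds the degeneracy, and vertices of minimum degree are put back greedily. -/
lemma SparseOn.exists_isEmb_of_degenerate [Nonempty W] {G : SimpleGraph V} {S : Finset V} {l : ℕ}
    (hS : SparseOn G S l) {R : SimpleGraph W} {Z : Finset W} {k d : ℕ}
    (hZ : ∀ z ∈ Z, #{y ∈ Z | Rᶜ.Adj z y} ≤ k)
    (hd : ∀ e, (e - 2) * (e + 1) ≤ 2 * l → e ≤ d)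
    (h1 : #S + d * k ≤ #Z) : ∃ f, IsEmb G S R Z f := by
  obtain ⟨f, hf, -⟩ := (isEmb_empty G R Z fun _ => Classical.arbitrary W).extend_greedy (S := S)
    (by simp) hZ (by
    intro T hTS hT
    obtain ⟨w, hw, hle⟩ := exists_degIn_mul_card_le G (empty_ssubset.1 hT)
    refine ⟨w, hw, by simp, ?_⟩
    have h2 := hd (degIn G T w) (by
      have h3 := degIn_lt_card G hw
      have h4 := hS T hTS
      refine (Nat.mul_le_mul_left _ h3).trans ?_
      rw [Nat.sub_mul]
      omega)
    have h3 := card_le_card hTS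
    have h4 := Nat.mul_le_mul_right k h2
    omega)
  exact ⟨f, hf⟩

lemma IsEmb.extend_leaves {G : SimpleGraph V} {Q S : Finset V} {R : SimpleGraph W}
    {Z : Finset W} {f₀ : V → W} {k : ℕ} (h₀ : IsEmb G Q R Z f₀) (hQS : Q ⊆ S)
    (hZ : ∀ z ∈ Z, #{y ∈ Z | Rᶜ.Adj z y} ≤ k) (hQ : ∀ w ∈ S, w ∉ Q → degIn G S w ≤ 1)
    (hle : #S + k ≤ #Z) : ∃ f, IsEmb G S R Z f ∧ ∀ a ∈ Q, f a = f₀ a := by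
  refine h₀.extend_greedy hQS hZ fun T hTS hQT => ?_
  obtain ⟨w, hwT, hwQ⟩ := exists_of_ssubset hQT
  refine ⟨w, hwT, hwQ, ?_⟩
  have h1 := (degIn_mono G hTS w).trans (hQ w (hTS hwT) hwQ)
  have h2 := Nat.mul_le_mul_right k h1
  have h3 := card_le_card hTS
  omega

/-- With e = c + 2 the condition reads c(c + 3) ≤ 2l, and (c + 2)² ≤ 2c(c + 3) + 4. The square is
what is bounded because a degree and d get multiplied in the greedy count. -/
lemma exists_degeneracy_bound (l : ℕ) :
    ∃ d, d * d ≤ 4 * l + 4 ∧ ∀ e, (e - 2) * (e + 1) ≤ 2 * l → e ≤ d := by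
  have hbound : ∀ e, (e - 2) * (e + 1) ≤ 2 * l → e * e ≤ 4 * l + 4 := by
    intro e he
    rcases Nat.lt_or_ge e 2 with h | h
    · interval_cases e <;> omega
    · obtain ⟨c, rfl⟩ := Nat.exists_eq_add_of_le' h
      rw [Nat.add_sub_cancel] at he
      nlinarith [Nat.zero_le (c * c)]
  refine ⟨Nat.findGreatest (fun e => (e - 2) * (e + 1) ≤ 2 * l) (4 * l + 4),
    hbound _ (Nat.findGreatest_spec (P := fun e => (e - 2) * (e + 1) ≤ 2 * l) (Nat.zero_le _)
      (by simp)), fun e he => Nat.le_findGreatest ?_ he⟩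
  have := hbound e he
  nlinarith

/-- If some blue neighbourhood is large, T embeds inside it by degeneracy. Otherwise all blue
degrees are below #T + d(k - 1), and a vertex of minimum degree δ can be added: it must avoid fewer
than #T + δ * #T + δd(k - 1) vertices, where δ * #T ≤ 2 * #T + 2 * l and δd ≤ d² ≤ 4l + 4. -/
lemma SparseOn.exists_isEmb_of_card_le [Fintype W] [Nonempty W] {G : SimpleGraph V}
    {S : Finset V} {l : ℕ} (hS : SparseOn G S l) {R : SimpleGraph W} {k : ℕ}
    (hR : BookFreeCompl R k)
    (hcard : 3 * #S + 2 * l + (k - 1) * (4 * l + 4) ≤ Fintype.card W) :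
    ∃ f, IsEmb G S R univ f := by
  obtain ⟨d, hd, hdmax⟩ := exists_degeneracy_bound l
  suffices H : ∀ m, ∀ T ⊆ S, #T = m → ∃ f, IsEmb G T R univ f from H _ S subset_rfl rfl
  intro m
  induction m with
  | zero =>
    intro T _ hT
    rw [card_eq_zero] at hT
    subst hT
    exact ⟨_, isEmb_empty G R _ fun _ => Classical.arbitrary W⟩
  | succ m ih =>
    intro T hTS hT
    by_cases hx : ∃ x, #T + d * (k - 1) ≤ #({y | Rᶜ.Adj x y} : Finset W)
    · obtain ⟨x, hx⟩ := hx
      obtain ⟨f, hf⟩ := (hS.mono hTS).exists_isEmb_of_degenerate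
        (hR.card_filter_le (x := x) (by simp)) hdmax hx
      exact ⟨f, hf.mono_right (subset_univ _)⟩
    push Not at hx
    obtain ⟨w, hw, hle⟩ := exists_degIn_mul_card_le G (T := T) (card_pos.1 (by omega))
    obtain ⟨f, hf⟩ := ih (T.erase w) ((erase_subset _ _).trans hTS)
      (by rw [card_erase_of_mem hw]; omega)
    set N := {u ∈ T.erase w | G.Adj w u}
    have hN : #N = degIn G T w := degIn_erase_self G T w
    set bad := (T.erase w).image f ∪ N.biUnion fun a => ({y | Rᶜ.Adj (f a) y} : Finset W)
    have hbad : #bad < #(univ : Finset W) := by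
      have h1 : #((T.erase w).image f) + 1 = #T := by
        rw [hf.card_image, card_erase_add_one hw]
      have h2 : #(N.biUnion fun a => ({y | Rᶜ.Adj (f a) y} : Finset W)) ≤
          #N * (#T + d * (k - 1)) :=
        card_biUnion_le_card_mul _ _ _ fun a _ => (hx _).le
      have h3 : #bad ≤ _ := card_union_le ((T.erase w).image f)
        (N.biUnion fun a => ({y | Rᶜ.Adj (f a) y} : Finset W))
      have h4 := hS T hTS
      have h5 : degIn G T w ≤ d := hdmax _ (by
        have h6 := degIn_lt_card G hw
        refine (Nat.mul_le_mul_left _ h6).trans ?_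
        rw [Nat.sub_mul]
        omega)
      have h6 : degIn G T w * (d * (k - 1)) ≤ (k - 1) * (4 * l + 4) := by
        rw [← mul_assoc, mul_comm]
        exact Nat.mul_le_mul_left _ ((Nat.mul_le_mul_right d h5).trans hd)
      have h7 := card_le_card hTS
      rw [hN, mul_add] at h2
      rw [card_univ]
      omega
    obtain ⟨z, -, hzb⟩ := exists_mem_notMem_of_card_lt_card hbad
    simp only [bad, mem_union, not_or] at hzb
    refine ⟨_, hf.update (mem_univ z) hzb.1 fun a ha hwa => ?_⟩
    by_contra hcon
    refine hzb.2 (mem_biUnion.2 ⟨a, by simp only [N, mem_filter]; exact ⟨ha, hwa⟩, ?_⟩)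
    simp only [mem_filter, mem_univ, true_and, SimpleGraph.compl_adj]
    exact ⟨fun e => hzb.1 (e ▸ mem_image_of_mem f ha), fun e => hcon e.symm⟩

end Greedy

/-! ### Putting leaves back -/

section Leaves

open Finset
open scoped Classical

variable {V W : Type*}

/-- The vertices of degree one in `S`. -/
noncomputable def leavesIn (G : SimpleGraph V) (S : Finset V) : Finset V :=
  {v ∈ S | degIn G S v = 1}

lemma mem_leavesIn {G : SimpleGraph V} {S : Finset V} {v : V} :
    v ∈ leavesIn G S ↔ v ∈ S ∧ degIn G S v = 1 := by
  simp [leavesIn]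

lemma eq_of_mem_leavesIn {G : SimpleGraph V} {S : Finset V} {w a b : V}
    (hw : w ∈ leavesIn G S) (ha : a ∈ S) (hb : b ∈ S) (hwa : G.Adj w a) (hwb : G.Adj w b) :
    a = b :=
  card_le_one.1 (mem_leavesIn.1 hw).2.le a (by simp [ha, hwa]) b (by simp [hb, hwb])

/-- Two adjacent leaves would be a component by themselves. -/
lemma CutConn.not_mem_leavesIn {G : SimpleGraph V} {S : Finset V} (h : CutConn G S)
    (hS : 3 ≤ #S) {v w : V} (hw : w ∈ leavesIn G S) (hvw : G.Adj v w) : v ∉ leavesIn G S := by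
  intro hv
  have hvS := (mem_leavesIn.1 hv).1
  have hwS := (mem_leavesIn.1 hw).1
  obtain ⟨a, ha, b, hb, hbT, hab⟩ := h {v, w} (by
    intro u hu
    simp only [mem_insert, mem_singleton] at hu
    rcases hu with rfl | rfl <;> assumption) (by simp) (by
    intro e
    rw [← e, card_pair hvw.ne] at hS
    omega)
  simp only [mem_insert, mem_singleton, not_or] at ha hbT
  rcases ha with rfl | rfl
  · exact hbT.2 (eq_of_mem_leavesIn hv hb hwS hab hvw)
  · exact hbT.1 (eq_of_mem_leavesIn hw hb hvS hab hvw.symm)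

/-- Leaves hanging at one vertex can be put back if its image has a large degree. -/
lemma IsEmb.extend_star [Fintype W] {G : SimpleGraph V} {S X : Finset V} {R : SimpleGraph W}
    {f₀ : V → W} {v : V} (h₀ : IsEmb G (S \ X) R univ f₀) (hX : X ⊆ leavesIn G S)
    (hvS : v ∈ S) (hvX : ∀ w ∈ X, G.Adj v w)
    (hdeg : #S ≤ #({y | R.Adj (f₀ v) y} : Finset W) + 1) : ∃ f, IsEmb G S R univ f := by
  have hv : v ∈ S \ X := mem_sdiff.2 ⟨hvS, fun h => (hvX v h).ne rfl⟩
  obtain ⟨f, hf, -⟩ := h₀.extend (S := S) sdiff_subset (by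
    intro T hTS hQT
    obtain ⟨w, hwT, hwQ⟩ := exists_of_ssubset hQT
    refine ⟨w, hwT, hwQ, fun f hf hfQ => ?_⟩
    have hwX : w ∈ X := by
      by_contra h
      exact hwQ (mem_sdiff.2 ⟨hTS hwT, h⟩)
    have hvT : v ∈ T.erase w := mem_erase.2 ⟨fun e => hwQ (e ▸ hv), hQT.1 hv⟩
    -- The image of v is used but is not its own neighbour, so it need not be avoided; this gains
    -- the one in `hdeg`.
    have hlt : #(((T.erase w).image f).erase (f v)) < #({y | R.Adj (f₀ v) y} : Finset W) := by
      rw [card_erase_of_mem (mem_image_of_mem f hvT), hf.card_image]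
      have h1 := card_erase_add_one hwT
      have h2 := card_le_card hTS
      have h3 := card_pos.2 ⟨v, hvT⟩
      omega
    obtain ⟨z, hz, hzf⟩ := exists_mem_notMem_of_card_lt_card hlt
    simp only [mem_filter, mem_univ, true_and] at hz
    rw [← hfQ v hv] at hz
    refine ⟨z, mem_univ z, fun h => hzf (mem_erase.2 ⟨hz.ne', h⟩), fun a ha hwa => ?_⟩
    have := eq_of_mem_leavesIn (hX hwX) (hTS (mem_of_mem_erase ha)) hvS hwa (hvX w hwX).symm
    subst this
    exact hz.symm)
  exact ⟨f, hf⟩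

lemma card_adj_add_card_compl_adj [Fintype W] (R : SimpleGraph W) (x : W) :
    #({y | R.Adj x y} : Finset W) + #({y | Rᶜ.Adj x y} : Finset W) + 1 = Fintype.card W := by
  have h1 : ({y | Rᶜ.Adj x y} : Finset W) = ({y | ¬ R.Adj x y} : Finset W).erase x := by
    ext y
    simp only [SimpleGraph.compl_adj, mem_filter, mem_univ, true_and, mem_erase]
    tauto
  have h2 := card_erase_add_one (s := ({y | ¬ R.Adj x y} : Finset W)) (a := x) (by simp)
  have h3 := card_filter_add_card_filter_not (s := (univ : Finset W)) (fun y => R.Adj x y)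
  rw [card_univ] at h3
  rw [h1]
  omega

/-- If every red degree is at least n - 1, the leaves fit back around the image of v. Otherwise some
x has n blue neighbours, forming Z. If some z in Z has red degree at least n - 1, the graph without
X is re-embedded in Z with v at z, and X is attached there. If none has, each vertex of Z has at
least n - k + 1 blue neighbours among the n - 1 vertices outside Z; a blue edge in Z would give a
blue book, so Z is a red clique on n vertices. -/
lemma exists_isEmb_of_star [Fintype W] [Nonempty W] {G : SimpleGraph V} {S X : Finset V}
    {l k n : ℕ} (hS : SparseOn G S l) {R : SimpleGraph W} (hR : BookFreeCompl R k) (hk : 1 ≤ k)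
    (hW : Fintype.card W + 1 = 2 * n) (hSn : #S ≤ n) (hn : (2 * l + 3) * k ≤ n)
    (hleaves : 2 * k ≤ #(leavesIn G S)) (hX : X ⊆ leavesIn G S) (hXk : k ≤ #X) {v : V}
    (hvS : v ∈ S) (hvX : ∀ w ∈ X, G.Adj v w) {f₀ : V → W} (h₀ : IsEmb G (S \ X) R univ f₀) :
    ∃ f, IsEmb G S R univ f := by
  have hn3 : 3 * k ≤ n := le_trans (Nat.mul_le_mul_right k (by omega)) hn
  by_cases hall : ∀ x, n ≤ #({y | R.Adj x y} : Finset W) + 1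
  · exact h₀.extend_star hX hvS hvX (hSn.trans (hall _))
  push Not at hall
  obtain ⟨x, hx⟩ := hall
  have hxb := card_adj_add_card_compl_adj R x
  obtain ⟨Z, hZx, hZn⟩ := exists_subset_card_eq
    (show n ≤ #({y | Rᶜ.Adj x y} : Finset W) by omega)
  have hZdeg := hR.card_filter_le (x := x) (Z := Z) fun z hz => by simpa using hZx hz
  by_cases hz : ∃ z ∈ Z, n ≤ #({y | R.Adj z y} : Finset W) + 1
  · obtain ⟨z, hzZ, hz⟩ := hz
    have hXS : X ⊆ S := hX.trans (filter_subset _ _)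
    have hvX' : v ∉ X := fun h => (hvX v h).ne rfl
    have hLS : (leavesIn G S).erase v ⊆ S := (erase_subset _ _).trans (filter_subset _ _)
    -- Stripping all leaves other than v frees the 2(k - 1) places that the pinned embedding needs.
    have hc1 : #(S \ (leavesIn G S).erase v) + 2 * (k - 1) ≤ #Z := by
      rw [card_sdiff_of_subset hLS]
      have := card_le_card hLS
      have := pred_card_le_card_erase (s := leavesIn G S) (a := v)
      omega
    obtain ⟨f, hf, hfv⟩ := (hS.mono sdiff_subset).exists_isEmb_pinned hZdeg hk hc1 (by omega)
      (show v ∈ S \ (leavesIn G S).erase v by simp [hvS]) hzZ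
    obtain ⟨g, hg, hgf⟩ := hf.extend_leaves (S := S \ X) (by
        refine sdiff_subset_sdiff subset_rfl fun w hw => mem_erase.2 ⟨?_, hX hw⟩
        rintro rfl
        exact hvX' hw) hZdeg (by
        intro w hw hwQ
        rw [mem_sdiff] at hw
        have : w ∈ leavesIn G S := by
          by_contra h
          exact hwQ (mem_sdiff.2 ⟨hw.1, fun h' => h (mem_of_mem_erase h')⟩)
        exact (degIn_mono G sdiff_subset w).trans (mem_leavesIn.1 this).2.le) (by
        rw [card_sdiff_of_subset hXS]
        omega)
    refine (hg.mono_right (subset_univ _)).extend_star hX hvS hvX ?_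
    rw [hgf v (by simp [hvS]), hfv]
    omega
  push Not at hz
  refine (exists_isEmb_of_clique G S (Z := Z) ?_ (by omega)).imp fun g hg =>
    hg.mono_right (subset_univ _)
  intro y hy z hz' hyz
  have key : ∀ u ∈ Z, n ≤ #(({w | Rᶜ.Adj u w} : Finset W) \ Z) + (k - 1) := by
    intro u hu
    have h1 := hz u hu
    have h2 := card_adj_add_card_compl_adj R u
    have h3 := hZdeg u hu
    have h4 := card_sdiff_add_card_inter ({w | Rᶜ.Adj u w} : Finset W) Z
    have h5 : ({w | Rᶜ.Adj u w} : Finset W) ∩ Z = {w ∈ Z | Rᶜ.Adj u w} := by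
      ext; simp [and_comm]
    rw [h5] at h4
    omega
  have h1 := key y hy
  have h2 := key z hz'
  have h3 := card_union_add_card_inter (({w | Rᶜ.Adj y w} : Finset W) \ Z)
    (({w | Rᶜ.Adj z w} : Finset W) \ Z)
  have h4 : #((({w | Rᶜ.Adj y w} : Finset W) \ Z) ∪ (({w | Rᶜ.Adj z w} : Finset W) \ Z)) ≤
      #(univ \ Z) := card_le_card (by
    intro w hw
    simp only [mem_union, mem_sdiff] at hw
    simp only [mem_sdiff, mem_univ, true_and]
    tauto)
  have h5 : #((({w | Rᶜ.Adj y w} : Finset W) \ Z) ∩ (({w | Rᶜ.Adj z w} : Finset W) \ Z)) ≤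
      #({w | Rᶜ.Adj y w ∧ Rᶜ.Adj z w} : Finset W) := card_le_card (by
    intro w hw
    simp only [mem_inter, mem_sdiff, mem_filter, mem_univ, true_and] at hw ⊢
    tauto)
  have h6 := hR y z hyz
  rw [card_sdiff_of_subset (subset_univ _), card_univ] at h4
  omega

/-- Leaves at distinct parents can be put back along a system of distinct representatives. -/
lemma IsEmb.extend_matching [Fintype W] {G : SimpleGraph V} {S P : Finset V} {R : SimpleGraph W}
    {f : V → W} {leaf : V → V} (hleaf : ∀ p ∈ P, leaf p ∈ leavesIn G S ∧ G.Adj p (leaf p))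
    (hPS : P ⊆ S) (hP : ∀ p ∈ P, p ∉ leavesIn G S) (hf : IsEmb G (S \ P.image leaf) R univ f)
    {g : P → W} (hg : Function.Injective g)
    (hgf : ∀ p : P, g p ∉ (S \ P.image leaf).image f ∧ R.Adj (f p) (g p)) :
    ∃ h, IsEmb G S R univ h := by
  have hinj : ∀ p ∈ P, ∀ q ∈ P, leaf p = leaf q → p = q := fun p hp q hq e =>
    eq_of_mem_leavesIn (hleaf p hp).1 (hPS hp) (hPS hq) (hleaf p hp).2.symm
      (e ▸ (hleaf q hq).2.symm)
  let h : V → W := fun v => if hv : ∃ p : P, leaf p = v then g hv.choose else f v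
  have hhl : ∀ p : P, h (leaf p) = g p := by
    intro p
    have hv : ∃ q : P, leaf q = leaf p := ⟨p, rfl⟩
    simp only [h, dif_pos hv]
    congr 1
    exact Subtype.ext (hinj _ hv.choose.2 _ p.2 hv.choose_spec)
  have hhf : ∀ v ∈ S \ P.image leaf, h v = f v := by
    intro v hv
    have hv' : ¬ ∃ p : P, leaf p = v := by
      rintro ⟨p, rfl⟩
      simp only [mem_sdiff, mem_image, not_exists, not_and] at hv
      exact hv.2 p p.2 rfl
    simp only [h, dif_neg hv']
  have hcases : ∀ v ∈ S, (∃ p : P, leaf p = v) ∨ v ∈ S \ P.image leaf := by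
    intro v hv
    by_cases hc : v ∈ P.image leaf
    · obtain ⟨p, hp, rfl⟩ := mem_image.1 hc
      exact Or.inl ⟨⟨p, hp⟩, rfl⟩
    · exact Or.inr (mem_sdiff.2 ⟨hv, hc⟩)
  have hPQ : ∀ p ∈ P, p ∈ S \ P.image leaf := by
    intro p hp
    refine mem_sdiff.2 ⟨hPS hp, fun hc => ?_⟩
    obtain ⟨q, hq, rfl⟩ := mem_image.1 hc
    exact hP _ hp (hleaf q hq).1
  have hadj : ∀ p : P, ∀ b ∈ S, G.Adj (leaf p) b → R.Adj (h (leaf p)) (h b) := by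
    intro p b hb hab
    have := eq_of_mem_leavesIn (hleaf p p.2).1 hb (hPS p.2) hab (hleaf p p.2).2.symm
    subst this
    rw [hhl, hhf _ (hPQ _ p.2)]
    exact (hgf p).2.symm
  refine ⟨h, fun _ _ => mem_univ _, fun a ha b hb hab => ?_, fun a ha b hb hab => ?_⟩
  · rcases hcases a ha with ⟨p, rfl⟩ | ha' <;> rcases hcases b hb with ⟨q, rfl⟩ | hb'
    · rw [hhl, hhl] at hab
      rw [hg hab]
    · rw [hhl, hhf b hb'] at hab
      exact absurd (hab ▸ mem_image_of_mem f hb') (hgf p).1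
    · rw [hhl, hhf a ha'] at hab
      exact absurd (hab ▸ mem_image_of_mem f ha') (hgf q).1
    · rw [hhf a ha', hhf b hb'] at hab
      exact hf.inj a ha' b hb' hab
  · rcases hcases a ha with ⟨p, rfl⟩ | ha'
    · exact hadj p b hb hab
    rcases hcases b hb with ⟨q, rfl⟩ | hb'
    · exact (hadj q a ha hab.symm).symm
    · rw [hhf a ha', hhf b hb']
      exact hf.adj a ha' b hb' hab

/-- The leaves go back if Hall's condition holds between the parents and the unused vertices. If a
set s of parents violates it, the unused vertices without red neighbours in the image of s form a
large set Z, joined to that image entirely in blue. If #s ≥ k, a blue edge in Z would have k pages,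
so Z is a red clique on at least n vertices. If #s < k, then Z lies in a blue neighbourhood and is
larger still, so the whole graph is embedded there afresh, its leaves last. -/
lemma exists_isEmb_of_matching [Fintype W] [Nonempty W] {G : SimpleGraph V} {S P : Finset V}
    {l k n : ℕ} (hS : SparseOn G S l) {R : SimpleGraph W} (hR : BookFreeCompl R k) (hk : 1 ≤ k)
    (hW : Fintype.card W + 1 = 2 * n) (hSn : #S ≤ n) (hn : (2 * l + 3) * k ≤ n) (hPk : #P = 2 * k)
    {leaf : V → V} (hleaf : ∀ p ∈ P, leaf p ∈ leavesIn G S ∧ G.Adj p (leaf p))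
    (hPS : P ⊆ S) (hP : ∀ p ∈ P, p ∉ leavesIn G S) {f : V → W}
    (hf : IsEmb G (S \ P.image leaf) R univ f) : ∃ h, IsEmb G S R univ h := by
  have hinj : ∀ p ∈ P, ∀ q ∈ P, leaf p = leaf q → p = q := fun p hp q hq e =>
    eq_of_mem_leavesIn (hleaf p hp).1 (hPS hp) (hPS hq) (hleaf p hp).2.symm
      (e ▸ (hleaf q hq).2.symm)
  have himL : P.image leaf ⊆ leavesIn G S := by
    intro w hw
    obtain ⟨p, hp, rfl⟩ := mem_image.1 hw
    exact (hleaf p hp).1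
  have hLS : leavesIn G S ⊆ S := filter_subset _ _
  have himc : #(P.image leaf) = 2 * k := by
    rw [card_image_of_injOn fun p hp q hq => hinj p hp q hq, hPk]
  have hPQ : ∀ p ∈ P, p ∈ S \ P.image leaf := fun p hp =>
    mem_sdiff.2 ⟨hPS hp, fun hc => hP p hp (himL hc)⟩
  set Y : Finset W := univ \ (S \ P.image leaf).image f with hY
  have hYc : #Y + #S = Fintype.card W + 2 * k := by
    have h1 := card_le_card (subset_univ ((S \ P.image leaf).image f))
    have h2 := card_le_card (himL.trans hLS)
    rw [hY, card_sdiff_of_subset (subset_univ _), card_univ, hf.card_image,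
      card_sdiff_of_subset (himL.trans hLS)]
    rw [card_univ, hf.card_image, card_sdiff_of_subset (himL.trans hLS)] at h1
    omega
  let t : P → Finset W := fun p => {y ∈ Y | R.Adj (f p) y}
  by_cases hall : ∀ s : Finset P, #s ≤ #(s.biUnion t)
  · obtain ⟨g, hg, hgt⟩ := (all_card_le_biUnion_card_iff_exists_injective t).1 hall
    refine hf.extend_matching hleaf hPS hP hg fun p => ?_
    have := hgt p
    simp only [t, hY, mem_filter, mem_sdiff, mem_univ, true_and] at this
    exact this
  push Not at hall
  obtain ⟨s, hs⟩ := hall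
  set Z := Y \ s.biUnion t with hZ
  have hZadj : ∀ p ∈ s, ∀ z ∈ Z, Rᶜ.Adj (f p) z := by
    intro p hp z hz
    simp only [hZ, mem_sdiff, mem_biUnion, not_exists, not_and] at hz
    rw [SimpleGraph.compl_adj]
    constructor
    · rintro rfl
      have h1 := hz.1
      simp only [hY, mem_sdiff, mem_univ, true_and] at h1
      exact h1 (mem_image_of_mem f (hPQ p p.2))
    · intro h
      exact hz.2 p hp (mem_filter.2 ⟨hz.1, h⟩)
  have hZc : #Y - #(s.biUnion t) ≤ #Z := le_card_sdiff _ _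
  have hsc : #s ≤ 2 * k := by
    have := card_le_univ s
    rwa [Fintype.card_coe, hPk] at this
  rcases Nat.lt_or_ge #s k with hlt | hge
  · obtain ⟨p, hp⟩ : s.Nonempty := card_pos.1 (by omega)
    have hZdeg := hR.card_filter_le (hZadj p hp)
    obtain ⟨z, hz⟩ : Z.Nonempty := card_pos.1 (by omega)
    have hLc := card_le_card himL
    have hLc' := card_le_card hLS
    obtain ⟨g, hg, -⟩ := (hS.mono sdiff_subset).exists_isEmb_pinned
      (S := S \ leavesIn G S) hZdeg hk (by
        rw [card_sdiff_of_subset hLS]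
        omega) (by omega) (mem_sdiff.2 ⟨hPS p.2, hP p p.2⟩) hz
    obtain ⟨h, hh, -⟩ := hg.extend_leaves (S := S) sdiff_subset hZdeg (by
      intro w hw hwQ
      have : w ∈ leavesIn G S := by
        by_contra h
        exact hwQ (mem_sdiff.2 ⟨hw, h⟩)
      exact (mem_leavesIn.1 this).2.le) (by omega)
    exact ⟨h, hh.mono_right (subset_univ _)⟩
  · refine (exists_isEmb_of_clique G S (Z := Z) ?_ (by omega)).imp fun g hg =>
      hg.mono_right (subset_univ _)
    intro y hy z hz hyz
    have h1 : s.image (fun p : P => f p) ⊆ ({w | Rᶜ.Adj y w ∧ Rᶜ.Adj z w} : Finset W) := by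
      intro w hw
      obtain ⟨p, hp, rfl⟩ := mem_image.1 hw
      simp only [mem_filter, mem_univ, true_and]
      exact ⟨(hZadj p hp y hy).symm, (hZadj p hp z hz).symm⟩
    have h2 := card_le_card h1
    rw [card_image_of_injOn] at h2
    · have := hR y z hyz
      omega
    · intro p _ q _ hpq
      exact Subtype.ext (hf.inj p (hPQ p p.2) q (hPQ q q.2) hpq)

/-- A graph with many leaves has either many leaves at one vertex or many parents of leaves. -/
lemma exists_isEmb_of_leaves [Fintype W] [Nonempty W] {G : SimpleGraph V} {S : Finset V}
    {l k n : ℕ} (hC : CutConn G S) (hS : SparseOn G S l) {R : SimpleGraph W}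
    (hR : BookFreeCompl R k) (hk : 1 ≤ k) (hW : Fintype.card W + 1 = 2 * n) (hSn : #S ≤ n)
    (hn : (2 * l + 3) * k ≤ n) (hS3 : 3 ≤ #S) (hleaves : 2 * k ^ 2 ≤ #(leavesIn G S))
    (ih : ∀ X ⊆ leavesIn G S, X.Nonempty → ∃ f, IsEmb G (S \ X) R univ f) :
    ∃ f, IsEmb G S R univ f := by
  have hLS : leavesIn G S ⊆ S := filter_subset _ _
  have hex : ∀ w ∈ leavesIn G S, ∃ p ∈ S, G.Adj p w := by
    intro w hw
    obtain ⟨p, hp⟩ := card_pos.1 (hC.degIn_pos (by omega) (hLS hw))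
    rw [mem_filter] at hp
    exact ⟨p, hp.1, hp.2.symm⟩
  choose! par hparS hpar using hex
  -- Fewer than 2k parents share at least 2k² leaves, so some parent has k of them.
  rcases Nat.lt_or_ge #((leavesIn G S).image par) (2 * k) with hlt | hge
  · obtain ⟨v, hv, hvk⟩ := exists_le_card_fiber_of_mul_le_card_of_maps_to (n := k)
      (fun w hw => mem_image_of_mem par hw) (by
        obtain ⟨w, hw⟩ : (leavesIn G S).Nonempty := card_pos.1 (by nlinarith)
        exact ⟨_, mem_image_of_mem par hw⟩) (by nlinarith)
    obtain ⟨w, hw, rfl⟩ := mem_image.1 hv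
    have hsub : ({u ∈ leavesIn G S | par u = par w} : Finset V) ⊆ leavesIn G S := filter_subset _ _
    obtain ⟨f, hf⟩ := ih _ hsub (card_pos.1 (by omega))
    refine exists_isEmb_of_star hS hR hk hW hSn hn (by nlinarith) hsub hvk (hparS w hw) ?_ hf
    intro u hu
    rw [mem_filter] at hu
    rw [← hu.2]
    exact hpar u hu.1
  · obtain ⟨P, hP, hPk⟩ := exists_subset_card_eq hge
    have hex : ∀ p ∈ P, ∃ w, w ∈ leavesIn G S ∧ G.Adj p w := by
      intro p hp
      obtain ⟨w, hw, rfl⟩ := mem_image.1 (hP hp)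
      exact ⟨w, hw, hpar w hw⟩
    choose! leaf hleaf using hex
    have hPne : P.Nonempty := card_pos.1 (by omega)
    obtain ⟨f, hf⟩ := ih (P.image leaf) (by
      intro w hw
      obtain ⟨p, hp, rfl⟩ := mem_image.1 hw
      exact (hleaf p hp).1) (hPne.image _)
    refine exists_isEmb_of_matching hS hR hk hW hSn hn hPk hleaf ?_ ?_ hf
    · intro p hp
      obtain ⟨w, hw, rfl⟩ := mem_image.1 (hP hp)
      exact hparS w hw
    · intro p hp
      exact hC.not_mem_leavesIn hS3 (hleaf p hp).1 (hleaf p hp).2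

end Leaves

/-! ### Few leaves and no long suspended path force few vertices; the induction -/

section Counting

open Finset
open scoped Classical

variable {V W : Type*}

/-- The vertices of `S` within distance `i` of a vertex whose degree is not two. -/
noncomputable def nearBranch (G : SimpleGraph V) (S : Finset V) : ℕ → Finset V
  | 0 => {v ∈ S | degIn G S v ≠ 2}
  | i + 1 => nearBranch G S i ∪ {v ∈ S | ∃ u ∈ nearBranch G S i, G.Adj u v}

lemma nearBranch_subset (G : SimpleGraph V) (S : Finset V) (i : ℕ) : nearBranch G S i ⊆ S := by
  induction i with
  | zero => exact filter_subset _ _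
  | succ i ih => exact union_subset ih (filter_subset _ _)

lemma nearBranch_mono (G : SimpleGraph V) (S : Finset V) : Monotone (nearBranch G S) :=
  monotone_nat_of_le_succ fun _ => subset_union_left

lemma mem_nearBranch_succ {G : SimpleGraph V} {S : Finset V} {i : ℕ} {u v : V} (hv : v ∈ S)
    (hu : u ∈ nearBranch G S i) (huv : G.Adj u v) : v ∈ nearBranch G S (i + 1) :=
  mem_union_right _ (mem_filter.2 ⟨hv, u, hu, huv⟩)

lemma exists_adj_of_mem_sdiff_nearBranch {G : SimpleGraph V} {S : Finset V} {i : ℕ} {v : V}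
    (hv : v ∈ nearBranch G S (i + 1) \ nearBranch G S i) :
    v ∈ S ∧ ∃ u ∈ nearBranch G S i, G.Adj u v := by
  obtain ⟨h1, h2⟩ := mem_sdiff.1 hv
  exact mem_filter.1 ((mem_union.1 h1).resolve_left h2)

/-- Sparseness bounds the sum of deg - 2 over the vertices of degree other than two by 2l. Each such
vertex has degree at least three or is a leaf, so deg + 2 per leaf is at least three; the two
inequalities combine. -/
lemma SparseOn.card_branch_le {G : SimpleGraph V} {S : Finset V} {l : ℕ} (hS : SparseOn G S l)
    (hpos : ∀ v ∈ S, 0 < degIn G S v) :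
    #(nearBranch G S 0) ≤ 2 * l + 2 * #(leavesIn G S) ∧
      ∑ v ∈ nearBranch G S 0, degIn G S v ≤ 6 * l + 4 * #(leavesIn G S) := by
  have h1 := hS S subset_rfl
  have h2 := sum_filter_add_sum_filter_not S (fun v => degIn G S v ≠ 2) (degIn G S)
  have h3 : ∑ v ∈ S with ¬ degIn G S v ≠ 2, degIn G S v = #{v ∈ S | ¬ degIn G S v ≠ 2} * 2 :=
    sum_const_nat fun v hv => by simpa using (mem_filter.1 hv).2
  have h4 := card_filter_add_card_filter_not (s := S) (fun v => degIn G S v ≠ 2)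
  have h5 : #(nearBranch G S 0) * 3 ≤
      ∑ v ∈ nearBranch G S 0, (degIn G S v + 2 * if degIn G S v = 1 then 1 else 0) := by
    rw [← smul_eq_mul]
    refine card_nsmul_le_sum _ _ _ fun v hv => ?_
    have hv' := mem_filter.1 hv
    have := hpos v hv'.1
    split_ifs <;> omega
  have h6 : #{v ∈ nearBranch G S 0 | degIn G S v = 1} ≤ #(leavesIn G S) :=
    card_le_card (filter_subset_filter _ (nearBranch_subset G S 0))
  rw [sum_add_distrib, ← mul_sum, ← card_filter] at h5
  change ∑ v ∈ nearBranch G S 0, degIn G S v + _ = _ at h2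
  change #(nearBranch G S 0) + _ = _ at h4
  omega

/-- Layers do not grow: a vertex outside the branch set has degree two, and one of its neighbours
lies in the previous layers, so at most one leads outwards. -/
lemma card_nearBranch_sdiff_le (G : SimpleGraph V) (S : Finset V) (i : ℕ) :
    #(nearBranch G S (i + 1) \ nearBranch G S i) ≤ ∑ v ∈ nearBranch G S 0, degIn G S v := by
  induction i with
  | zero =>
    have : nearBranch G S 1 \ nearBranch G S 0 ⊆
        (nearBranch G S 0).biUnion fun v => {u ∈ S | G.Adj v u} := by
      intro v hv
      obtain ⟨hvS, u, hu, huv⟩ := exists_adj_of_mem_sdiff_nearBranch hv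
      exact mem_biUnion.2 ⟨u, hu, mem_filter.2 ⟨hvS, huv⟩⟩
    exact (card_le_card this).trans card_biUnion_le
  | succ i ih =>
    refine le_trans ?_ ih
    have : nearBranch G S (i + 2) \ nearBranch G S (i + 1) ⊆
        (nearBranch G S (i + 1) \ nearBranch G S i).biUnion
          fun w => {u ∈ S | G.Adj w u ∧ u ∉ nearBranch G S (i + 1)} := by
      intro v hv
      obtain ⟨hvS, u, hu, huv⟩ := exists_adj_of_mem_sdiff_nearBranch hv
      refine mem_biUnion.2 ⟨u, mem_sdiff.2 ⟨hu, fun h => ?_⟩, mem_filter.2 ⟨hvS, huv, (mem_sdiff.1 hv).2⟩⟩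
      exact (mem_sdiff.1 hv).2 (mem_nearBranch_succ hvS h huv)
    refine (card_le_card this).trans ((card_biUnion_le_card_mul _ _ 1 fun w hw => ?_).trans
      (mul_one _).le)
    obtain ⟨hwS, u, hu, huw⟩ := exists_adj_of_mem_sdiff_nearBranch hw
    have hw2 : #({x ∈ S | G.Adj w x} : Finset V) = 2 := by
      change degIn G S w = 2
      by_contra h
      exact (mem_sdiff.1 hw).2 (nearBranch_mono G S (Nat.zero_le i) (mem_filter.2 ⟨hwS, h⟩))
    have hsub : ({x ∈ S | G.Adj w x ∧ x ∉ nearBranch G S (i + 1)} : Finset V) ⊆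
        ({x ∈ S | G.Adj w x} : Finset V).erase u := by
      intro x hx
      rw [mem_filter] at hx
      refine mem_erase.2 ⟨?_, mem_filter.2 ⟨hx.1, hx.2.1⟩⟩
      rintro rfl
      exact hx.2.2 (nearBranch_mono G S (Nat.le_succ i) hu)
    have h1 := card_le_card hsub
    rwa [card_erase_of_mem (mem_filter.2 ⟨nearBranch_subset G S i hu, huw.symm⟩), hw2] at h1

lemma card_nearBranch_le (G : SimpleGraph V) (S : Finset V) (i : ℕ) :
    #(nearBranch G S i) ≤ #(nearBranch G S 0) + i * ∑ v ∈ nearBranch G S 0, degIn G S v := by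
  induction i with
  | zero => simp
  | succ i ih =>
    have h1 := card_nearBranch_sdiff_le G S i
    have h2 := card_sdiff_add_card_eq_card (nearBranch_mono G S (Nat.le_succ i))
    rw [add_mul, one_mul]
    simp only [Nat.succ_eq_add_one] at h2
    omega

lemma IsSuspended.reverse {G : SimpleGraph V} {S : Finset V} {m : ℕ} {x : ℕ → V}
    (hx : IsSuspended G S m x) : IsSuspended G S m fun t => x (m - t) where
  inj s hs t ht h := by
    have := hx.inj _ (by omega) _ (by omega) h
    omega
  adj t ht := by
    have := (hx.adj (m - (t + 1)) (by omega)).symm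
    rwa [show m - (t + 1) + 1 = m - t by omega] at this
  mem t _ := hx.mem _ (by omega)
  deg t _ := hx.deg _ (by omega)

lemma IsSuspended.take {G : SimpleGraph V} {S : Finset V} {m m' : ℕ} {x : ℕ → V}
    (hx : IsSuspended G S m x) (h : m' ≤ m) : IsSuspended G S m' x where
  inj s hs t ht := hx.inj s (by omega) t (by omega)
  adj t ht := hx.adj t (by omega)
  mem t _ := hx.mem t (by omega)
  deg t _ := hx.deg t (by omega)

lemma IsSuspended.append {G : SimpleGraph V} {S : Finset V} {m : ℕ} {x : ℕ → V}
    (hx : IsSuspended G S m x) {y : V} (hy : y ∈ S) (hd : degIn G S y = 2)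
    (hadj : G.Adj (x m) y) (hne : ∀ t ≤ m, x t ≠ y) :
    IsSuspended G S (m + 1) fun t => if t ≤ m then x t else y where
  inj s hs t ht h := by
    split_ifs at h
    · exact hx.inj s (by omega) t (by omega) h
    · exact absurd h (hne s (by omega))
    · exact absurd h.symm (hne t (by omega))
    · omega
  adj t ht := by
    rw [if_pos (by omega)]
    split_ifs with h
    · exact hx.adj t (by omega)
    · rwa [show t = m by omega]
  mem t ht := by
    split_ifs with h
    · exact hx.mem t h
    · exact hy
  deg t ht := by
    split_ifs with h
    · exact hx.deg t h
    · exact hd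

/-- A suspended path that cannot be prolonged at its end stops at a vertex whose degree is not two,
or closes to a cycle. -/
lemma IsSuspended.end_adj_or_card_le {G : SimpleGraph V} {S : Finset V} {m : ℕ} {x : ℕ → V}
    (hx : IsSuspended G S m x) (hC : CutConn G S)
    (hmax : ∀ y, ¬ IsSuspended G S (m + 1) fun t => if t ≤ m then x t else y) :
    (∃ u ∈ nearBranch G S 0, G.Adj u (x m)) ∨ #S ≤ m + 1 := by
  by_contra! hcon
  obtain ⟨hU, hS⟩ := hcon
  have hd := hx.deg m le_rfl
  obtain ⟨y, hy, hyne⟩ := exists_mem_ne (show 1 < #{u ∈ S | G.Adj (x m) u} by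
    unfold degIn at hd; omega) (x (m - 1))
  rw [mem_filter] at hy
  have hyd : degIn G S y = 2 := by
    by_contra h
    exact hU y (mem_filter.2 ⟨hy.1, h⟩) hy.2.symm
  have hin : ∃ j ≤ m, x j = y := by
    by_contra! h
    exact hmax y (hx.append hy.1 hyd hy.2 h)
  obtain ⟨j, hj, rfl⟩ := hin
  have hjm : j ≠ m := by rintro rfl; exact hy.2.ne rfl
  have hjm1 : j ≠ m - 1 := by rintro rfl; exact hyne rfl
  -- An interior x j would have x m as a third neighbour, so the path closes up at x 0.
  rcases Nat.eq_zero_or_pos j with rfl | hj0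
  swap
  · obtain ⟨i, rfl⟩ := Nat.exists_eq_add_of_le' hj0
    rcases hx.eq_of_adj (t := i) (by omega) (hx.mem m le_rfl) hy.2.symm with h | h
    · have := hx.inj _ le_rfl _ (by omega) h
      omega
    · have := hx.inj _ le_rfl _ (by omega) h
      omega
  have hcard : #((range (m + 1)).image x) = m + 1 := by
    rw [card_image_of_injOn, card_range]
    intro s hs t ht h
    simp only [coe_range, Set.mem_Iio] at hs ht
    exact hx.inj s (by omega) t (by omega) h
  -- No edge leaves a cycle of vertices of degree two, so by connectedness the cycle would be all of
  -- S.
  obtain ⟨a, ha, b, hb, hbT, hab⟩ := hC ((range (m + 1)).image x) (by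
      intro v hv
      obtain ⟨t, ht, rfl⟩ := mem_image.1 hv
      exact hx.mem t (by simpa [Nat.lt_succ_iff] using ht)) ⟨x 0, mem_image_of_mem x (by simp)⟩ (by
      intro e
      rw [e] at hcard
      omega)
  obtain ⟨t, ht, rfl⟩ := mem_image.1 ha
  rw [mem_range] at ht
  have hno : ∀ s ≤ m, b ≠ x s := by
    rintro s hs rfl
    exact hbT (mem_image_of_mem x (by simpa [Nat.lt_succ_iff] using hs))
  have hm2 : 2 ≤ m := by omega
  rcases Nat.eq_zero_or_pos t with rfl | ht0
  · rcases eq_or_eq_of_degIn_eq_two (hx.deg 0 (by omega)) (hx.mem 1 (by omega)) (hx.mem m le_rfl)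
      (fun e => by have := hx.inj _ (by omega) _ le_rfl e; omega) (hx.adj 0 (by omega)) hy.2.symm
      hb hab with h | h
    · exact hno 1 (by omega) h
    · exact hno m le_rfl h
  rcases Nat.lt_or_ge t m with htm | htm
  · obtain ⟨i, rfl⟩ := Nat.exists_eq_add_of_le' ht0
    rcases hx.eq_of_adj (t := i) (by omega) hb hab with h | h
    · exact hno _ (by omega) h
    · exact hno _ (by omega) h
  · obtain rfl : t = m := by omega
    have h1 := hx.adj (t - 1) (by omega)
    rw [show t - 1 + 1 = t by omega] at h1
    rcases eq_or_eq_of_degIn_eq_two hd (hx.mem (t - 1) (by omega)) (hx.mem 0 (by omega))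
      (fun e => by have := hx.inj _ (by omega) _ (by omega) e; omega) h1.symm hy.2 hb hab with h | h
    · exact hno _ (by omega) h
    · exact hno _ (by omega) h

lemma IsSuspended.mem_nearBranch {G : SimpleGraph V} {S : Finset V} {m : ℕ} {x : ℕ → V}
    (hx : IsSuspended G S m x) {u : V} (hu : u ∈ nearBranch G S 0) (hux : G.Adj u (x m)) :
    ∀ i ≤ m, x (m - i) ∈ nearBranch G S (i + 1) := by
  intro i
  induction i with
  | zero => exact fun _ => mem_nearBranch_succ (hx.mem m le_rfl) hu hux
  | succ i ih =>
    intro hi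
    have h1 := hx.adj (m - (i + 1)) (by omega)
    rw [show m - (i + 1) + 1 = m - i by omega] at h1
    exact mem_nearBranch_succ (hx.mem _ (by omega)) (ih (by omega)) h1.symm

/-- A vertex of degree two lies on an unprolongable suspended path with at most 3k + 1 vertices,
both ends of which are next to a vertex of degree other than two; the nearer end puts it within
distance (3k + 2)/2 of such a vertex. Summing the layers gives the bound. -/
lemma CutConn.card_le_of_no_suspended {G : SimpleGraph V} {S : Finset V} {l k : ℕ}
    (hC : CutConn G S) (hS : SparseOn G S l) (hno : ∀ x, ¬ IsSuspended G S (3 * k + 1) x)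
    (hcard : 3 * k + 1 < #S) (hk : 1 ≤ k) :
    #S ≤ (9 * k + 8) * l + (6 * k + 6) * #(leavesIn G S) := by
  have hsub : S ⊆ nearBranch G S ((3 * k + 2) / 2) := by
    intro w hw
    by_cases hd : degIn G S w = 2
    swap
    · exact nearBranch_mono G S (Nat.zero_le _) (mem_filter.2 ⟨hw, hd⟩)
    let P : ℕ → Prop := fun m => ∃ x, IsSuspended G S m x ∧ ∃ j ≤ m, x j = w
    have hP : ∃ m, P m ∧ ¬ P (m + 1) := by
      by_contra! hcon
      have : ∀ m, P m := by
        intro m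
        induction m with
        | zero => exact ⟨fun _ => w, ⟨⟨by simp, by simp⟩, by simp [hw], by simp [hd]⟩, 0, le_rfl, rfl⟩
        | succ m ih => exact hcon m ih
      obtain ⟨x, hx, -⟩ := this (3 * k + 1)
      exact hno x hx
    obtain ⟨m, ⟨x, hx, j, hj, rfl⟩, hmax⟩ := hP
    have hm : m ≤ 3 * k := by
      by_contra h
      exact hno x (hx.take (by omega))
    have h1 := hx.end_adj_or_card_le hC fun y hy => hmax ⟨_, hy, j, by omega, by simp [hj]⟩
    have h2 := hx.reverse.end_adj_or_card_le hC fun y hy =>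
      hmax ⟨_, hy, m - j, by omega, by simp [Nat.sub_sub_self hj]⟩
    obtain ⟨u, hu, hux⟩ := h1.resolve_right (by omega)
    obtain ⟨u', hu', hux'⟩ := h2.resolve_right (by omega)
    have h3 := hx.mem_nearBranch hu hux (m - j) (by omega)
    have h4 := hx.reverse.mem_nearBranch hu' hux' j hj
    simp only [Nat.sub_sub_self hj] at h3 h4
    rcases Nat.le_total (2 * j) m with h | h
    · exact nearBranch_mono G S (by omega) h4
    · exact nearBranch_mono G S (by omega) h3
  have h1 := (card_le_card hsub).trans (card_nearBranch_le G S _)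
  obtain ⟨h2, h3⟩ := hS.card_branch_le fun v hv => hC.degIn_pos (by omega) hv
  have h4 : (3 * k + 2) / 2 * 2 ≤ 3 * k + 2 := Nat.div_mul_le_self _ _
  have h5 := Nat.mul_le_mul_left ((3 * k + 2) / 2) h3
  have h6 := Nat.mul_le_mul_right (3 * l + 2 * #(leavesIn G S)) h4
  nlinarith

/-- The embedding theorem: a sparse connected graph on at most `n` vertices embeds into every graph
on `2 n - 1` vertices whose complement contains no book with `k` pages. -/
theorem exists_isEmb_of_bookFreeCompl [Fintype W] [Nonempty W] {R : SimpleGraph W} {k l n : ℕ}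
    (hR : BookFreeCompl R k) (hk : 1 ≤ k) (hW : Fintype.card W + 1 = 2 * n)
    (hn : (2 * l + 3) * k ≤ n)
    (hsmall : 3 * (3 * k + 1) + 2 * l + (k - 1) * (4 * l + 4) ≤ Fintype.card W)
    (hbase : 3 * ((9 * k + 8) * l + (6 * k + 6) * (2 * k ^ 2 - 1)) + 2 * l +
      (k - 1) * (4 * l + 4) ≤ Fintype.card W)
    (G : SimpleGraph V) (S : Finset V) (hSn : #S ≤ n) (hC : CutConn G S) (hS : SparseOn G S l) :
    ∃ f, IsEmb G S R univ f := by
  -- The graph varies along with S, because the shortcut adds an edge that G need not have.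
  induction hs : #S using Nat.strong_induction_on generalizing G S with
  | _ s ih =>
    subst hs
    rcases Nat.lt_or_ge (3 * k + 1) #S with hlt | hle
    swap
    · exact hS.exists_isEmb_of_card_le hR (by omega)
    rcases Nat.lt_or_ge #(leavesIn G S) (2 * k ^ 2) with hL | hL
    swap
    · refine exists_isEmb_of_leaves hC hS hR hk hW hSn hn (by omega) hL fun X hX hXne => ?_
      have hlt' : #(S \ X) < #S :=
        card_lt_card (sdiff_ssubset (hX.trans (filter_subset _ _)) hXne)
      exact ih _ hlt' G (S \ X) (by omega)
        (hC.sdiff X fun w hw => (mem_leavesIn.1 (hX hw)).2.le) (hS.mono sdiff_subset) rfl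
    by_cases hx : ∃ x, IsSuspended G S (3 * k + 1) x
    · obtain ⟨x, hx⟩ := hx
      have hlt' : #(S.erase (x 1)) < #S := card_erase_lt_of_mem (hx.mem 1 (by omega))
      obtain ⟨f, hf⟩ := ih _ hlt' (shortcut G x) (S.erase (x 1)) (by omega)
        (hx.cutConn_shortcut (by omega) hC) (hx.sparseOn_shortcut (by omega) hS) rfl
      exact hx.exists_isEmb_of_shortcut hR hk (by omega) hf
    · push Not at hx
      have h1 := hC.card_le_of_no_suspended hS hx hlt hk
      have h2 : (6 * k + 6) * #(leavesIn G S) ≤ (6 * k + 6) * (2 * k ^ 2 - 1) :=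
        Nat.mul_le_mul_left _ (by omega)
      exact hS.exists_isEmb_of_card_le hR (by omega)

end Counting

/-! ### From finite-set embeddings to graph containment -/

section Transfer

open Finset
open scoped Classical

variable {V W : Type*}

lemma cutConn_univ [Fintype V] {G : SimpleGraph V} (hG : G.Connected) : CutConn G univ := by
  intro T _ hne hT
  obtain ⟨a, ha⟩ := hne
  obtain ⟨b, hb⟩ : ∃ b, b ∉ T := by
    by_contra! h
    exact hT (eq_univ_of_forall h)
  obtain ⟨p⟩ := hG.preconnected a b
  obtain ⟨d, -, hd1, hd2⟩ := p.exists_boundary_dart (T : Set V) ha hb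
  exact ⟨d.fst, hd1, d.snd, mem_univ _, hd2, d.adj⟩

lemma sum_degIn_univ [Fintype V] (G : SimpleGraph V) [Fintype G.edgeSet] :
    ∑ v, degIn G univ v = 2 * #G.edgeFinset := by
  have h : #G.edgeFinset = #(@SimpleGraph.edgeFinset V G
      (@SimpleGraph.fintypeEdgeSet V G _ (Classical.decRel _))) := by
    congr!
  rw [h, ← SimpleGraph.sum_degrees_eq_twice_card_edges]
  refine sum_congr rfl fun v _ => ?_
  rw [← SimpleGraph.card_neighborFinset_eq_degree]
  unfold degIn
  congr 1
  ext u
  simp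

lemma IsEmb.isContained [Fintype V] {G : SimpleGraph V} {R : SimpleGraph W} {Z : Finset W}
    {f : V → W} (hf : IsEmb G univ R Z f) : G ⊑ R :=
  ⟨⟨⟨f, fun {a b} hab => hf.adj a (mem_univ a) b (mem_univ b) hab⟩,
    fun a b hab => hf.inj a (mem_univ a) b (mem_univ b) hab⟩⟩

lemma book_adj_spine (k : ℕ) : (book k).Adj (Sum.inl 0) (Sum.inl 1) := by
  simp [book, graphJoin]

lemma book_adj_page (k : ℕ) (i : Fin 2) (j : Fin k) : (book k).Adj (Sum.inl i) (Sum.inr j) := by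
  simp [book, graphJoin]

lemma bookFreeCompl_of_not_isContained [Fintype W] {R : SimpleGraph W} {k : ℕ}
    (h : ¬ book k ⊑ Rᶜ) : BookFreeCompl R k := by
  intro u v huv
  by_contra! hcon
  obtain ⟨C, hC, hCk⟩ := exists_subset_card_eq hcon
  let e : Fin k ≃ C := (C.equivFinOfCardEq hCk).symm
  have he : ∀ j, Rᶜ.Adj u (e j) ∧ Rᶜ.Adj v (e j) := fun j => by simpa using hC (e j).2
  let f : Fin 2 ⊕ Fin k → W := Sum.elim ![u, v] fun j => e j
  have hspine : ∀ i (j : Fin k), Rᶜ.Adj (f (Sum.inl i)) (f (Sum.inr j)) := by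
    intro i j
    fin_cases i
    · exact (he j).1
    · exact (he j).2
  have hinl : ∀ i i' : Fin 2, i ≠ i' → Rᶜ.Adj (f (Sum.inl i)) (f (Sum.inl i')) := by
    intro i i' hne
    fin_cases i <;> fin_cases i'
    · exact absurd rfl hne
    · exact huv
    · exact huv.symm
    · exact absurd rfl hne
  refine h ⟨⟨⟨f, ?_⟩, ?_⟩⟩
  · rintro (i | i) (j | j) hij
    · exact hinl i j fun e => hij.ne (by rw [e])
    · exact hspine i j
    · exact (hspine j i).symm
    · simp [book, graphJoin] at hij
  · rintro (i | i) (j | j) hij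
    · by_contra hne
      exact (hinl i j fun e => hne (by rw [e])).ne hij
    · exact absurd hij (hspine i j).ne
    · exact absurd hij.symm (hspine j i).ne
    · rw [e.injective (Subtype.ext hij)]

end Transfer

/-! ### The extremal colouring and the colour classes of a book -/

section LowerBound

/-- The disjoint union of two complete graphs, on the vertices below `m` and on the others. -/
def twoCliques (N m : ℕ) : SimpleGraph (Fin N) where
  Adj i j := i ≠ j ∧ (i.val < m ↔ j.val < m)
  symm := ⟨fun _ _ h => ⟨h.1.symm, h.2.symm⟩⟩
  loopless := ⟨fun _ h => h.1 rfl⟩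

/-- A connected graph stays inside one clique, and both cliques are too small for it. -/
lemma not_isContained_twoCliques {V : Type*} [Fintype V] {G : SimpleGraph V} (hG : G.Connected)
    {N m : ℕ} (hm : m < Fintype.card V) (hN : N < m + Fintype.card V) :
    ¬ G ⊑ twoCliques N m := by
  rintro ⟨f⟩
  obtain ⟨r⟩ := hG.nonempty
  have hconst : ∀ v, (f r).val < m ↔ (f v).val < m := by
    intro v
    obtain ⟨p⟩ := hG.preconnected r v
    induction p with
    | nil => rfl
    | cons h _ ih => exact (f.toHom.map_adj h).2.trans ih
  by_cases hr : (f r).val < m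
  · have := Fintype.card_le_of_injective (fun v => (⟨(f v).val, (hconst v).1 hr⟩ : Fin m))
      fun a b hab => f.injective (Fin.ext (by simpa using hab))
    rw [Fintype.card_fin] at this
    omega
  · have hlt : ∀ v, (f v).val - m < N - m := fun v => by
      have := (hconst v).not.1 hr
      have := (f v).isLt
      omega
    have := Fintype.card_le_of_injective (fun v => (⟨(f v).val - m, hlt v⟩ : Fin (N - m)))
      fun a b hab => by
        have h1 := (hconst a).not.1 hr
        have h2 := (hconst b).not.1 hr
        simp only [Fin.mk.injEq] at hab
        have h3 : (f a).val = (f b).val := by omega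
        exact f.injective (Fin.ext h3)
    rw [Fintype.card_fin] at this
    omega

lemma not_book_isContained_compl_twoCliques {k : ℕ} (hk : 1 ≤ k) (N m : ℕ) :
    ¬ book k ⊑ (twoCliques N m)ᶜ := by
  rintro ⟨f⟩
  have h1 := f.toHom.map_adj (book_adj_spine k)
  have h2 := f.toHom.map_adj (book_adj_page k 0 ⟨0, hk⟩)
  have h3 := f.toHom.map_adj (book_adj_page k 1 ⟨0, hk⟩)
  simp only [twoCliques, SimpleGraph.compl_adj] at h1 h2 h3
  tauto

/-- The proper colouring of a book in which all the pages get the same colour. -/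
def bookColoring (k : ℕ) : (book k).Coloring (Fin 3) :=
  SimpleGraph.Coloring.mk (Sum.elim ![0, 1] fun _ => 2) (by
    rintro (i | i) (j | j) hij
    · fin_cases i <;> fin_cases j <;> first | exact absurd rfl hij.ne | simp
    · fin_cases i <;> simp
    · fin_cases j <;> simp
    · simp [book, graphJoin] at hij)

lemma bookColoring_inl (k : ℕ) (i : Fin 2) : bookColoring k (Sum.inl i) = ![0, 1] i := rfl

lemma bookColoring_inr (k : ℕ) (j : Fin k) : bookColoring k (Sum.inr j) = 2 := rfl

/-- The spine and one page form a triangle, which uses all three colours. This gives the chromatic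
number, and also that no colour class is empty. -/
lemma bookColoring_surjective {k : ℕ} (hk : 1 ≤ k) (C : (book k).Coloring (Fin 3)) :
    Function.Surjective C := by
  intro c
  have key : ∀ a b c d : Fin 3, a ≠ b → a ≠ c → b ≠ c → a = d ∨ b = d ∨ c = d := by decide
  rcases key _ _ _ c (C.valid (book_adj_spine k)) (C.valid (book_adj_page k 0 ⟨0, hk⟩))
    (C.valid (book_adj_page k 1 ⟨0, hk⟩)) with h | h | h
  exacts [⟨_, h⟩, ⟨_, h⟩, ⟨_, h⟩]

lemma chromaticNumber_book {k : ℕ} (hk : 1 ≤ k) : (book k).chromaticNumber = 3 := by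
  have := (SimpleGraph.chromaticNumber_eq_iff_forall_surjective
    (n := 3) ⟨bookColoring k⟩).2 (bookColoring_surjective hk)
  exact_mod_cast this

lemma chromaticSurplus_book {k : ℕ} (hk : 1 ≤ k) : chromaticSurplus (book k) = 1 := by
  have h3 : (book k).chromaticNumber.toNat = 3 := by rw [chromaticNumber_book hk]; rfl
  unfold chromaticSurplus
  rw [h3]
  refine le_antisymm (Nat.sInf_le ⟨bookColoring k, 0, ?_⟩) (le_csInf ⟨_, bookColoring k, 0, rfl⟩ ?_)
  · have : (bookColoring k).colorClass 0 = {Sum.inl 0} := by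
      ext v
      change bookColoring k v = 0 ↔ v = Sum.inl 0
      rcases v with i | i
      · fin_cases i <;> simp [bookColoring_inl]
      · simp [bookColoring_inr]
    rw [this, Set.ncard_singleton]
  · rintro m ⟨C, c, rfl⟩
    obtain ⟨v, hv⟩ := bookColoring_surjective hk C c
    exact (Set.ncard_pos (Set.toFinite _)).2 ⟨v, hv⟩

end LowerBound

/-! ### The Ramsey number and the arithmetic -/

section RamseyNumber

open Finset

lemma ramseyNumber_book_eq {V : Type*} [Fintype V] {G : SimpleGraph V} (hG : G.Connected) {k n : ℕ}
    (hk : 1 ≤ k) (hV : Fintype.card V = n)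
    (hupper : ∀ R : SimpleGraph (Fin (2 * n - 1)), G ⊑ R ∨ book k ⊑ Rᶜ) :
    ramseyNumber G (book k) = 2 * n - 1 := by
  have := hG.nonempty
  have hn : 0 < n := hV ▸ Fintype.card_pos
  refine le_antisymm (Nat.sInf_le ⟨by omega, hupper⟩) (le_csInf ⟨_, by omega, hupper⟩ ?_)
  rintro N ⟨-, hN⟩
  by_contra! hlt
  rcases hN (twoCliques N (n - 1)) with h | h
  · exact not_isContained_twoCliques hG (by omega) (by omega) h
  · exact not_book_isContained_compl_twoCliques hk _ _ h

lemma isContained_or_book_isContained_compl {V : Type*} [Fintype V] {G : SimpleGraph V}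
    [Fintype G.edgeSet] (hG : G.Connected) {k n l : ℕ} (hk : 1 ≤ k) (hn : 34 * k ^ 3 ≤ n)
    (hV : Fintype.card V = n) (hedges : #G.edgeFinset ≤ n + l)
    (hl : l * (119 * k ^ 2 + 62 * k) ≤ n) (R : SimpleGraph (Fin (2 * n - 1))) :
    G ⊑ R ∨ book k ⊑ Rᶜ := by
  by_contra hcon
  rw [not_or] at hcon
  -- Substituting k = j + 1 removes the truncated subtractions k - 1 and 2k² - 1 from the size
  -- conditions.
  obtain ⟨j, rfl⟩ := Nat.exists_eq_add_of_le' hk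
  have hj2 := Nat.zero_le (j ^ 2)
  have hj3 := Nat.zero_le (j ^ 3)
  have hlj := Nat.zero_le (l * j)
  have hlj2 := Nat.zero_le (l * j ^ 2)
  have hsub : 2 * (j + 1) ^ 2 - 1 = 2 * j ^ 2 + 4 * j + 1 := by
    have : 2 * (j + 1) ^ 2 = 2 * j ^ 2 + 4 * j + 1 + 1 := by ring
    omega
  have hW : Fintype.card (Fin (2 * n - 1)) + 1 = 2 * n := by
    rw [Fintype.card_fin]
    have : 0 < n := by nlinarith
    omega
  have hne : Nonempty (Fin (2 * n - 1)) := ⟨⟨0, by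
    have : 0 < n := by nlinarith
    omega⟩⟩
  have hC := cutConn_univ hG
  obtain ⟨f, hf⟩ := exists_isEmb_of_bookFreeCompl (l := l)
    (bookFreeCompl_of_not_isContained hcon.2) hk hW (by nlinarith)
    (by rw [Nat.add_sub_cancel]; nlinarith) (by rw [Nat.add_sub_cancel, hsub]; nlinarith)
    G univ (by rw [card_univ, hV]) hC (hC.sparseOn (by
      rw [sum_degIn_univ, card_univ, hV]
      omega))
  exact hcon.1 hf.isContained

end RamseyNumber

theorem theorem1p6 (k n : ℕ) (hk : 1 ≤ k) (hn : 34 * k ^ 3 ≤ n)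
    {V : Type*} [Fintype V] (G : SimpleGraph V) [Fintype G.edgeSet]
    (hconn : G.Connected) (hcard : Fintype.card V = n)
    (hedges : (G.edgeFinset.card : ℝ) ≤ n * (1 + 1 / (119 * (k : ℝ) ^ 2 + 62 * k))) :
    ramseyNumber G (book k) = 2 * n - 1 ∧ IsRamseyGood G (book k) := by
  -- The excess l is the number of edges minus n, truncated to zero for trees.
  have hl : (G.edgeFinset.card - n) * (119 * k ^ 2 + 62 * k) ≤ n := by
    rcases Nat.le_total G.edgeFinset.card n with h | h
    · simp [Nat.sub_eq_zero_of_le h]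
    · have hk' : (1 : ℝ) ≤ k := by exact_mod_cast hk
      have hpos : (0 : ℝ) < 119 * (k : ℝ) ^ 2 + 62 * k := by positivity
      have h1 : (G.edgeFinset.card : ℝ) - n ≤ n / (119 * (k : ℝ) ^ 2 + 62 * k) := by
        rw [mul_add, mul_one, mul_one_div] at hedges
        linarith
      rw [le_div_iff₀ hpos] at h1
      have h2 : (((G.edgeFinset.card - n) * (119 * k ^ 2 + 62 * k) : ℕ) : ℝ) ≤ n := by
        push_cast [Nat.cast_sub h]
        exact h1
      exact_mod_cast h2
  have hr : ramseyNumber G (book k) = 2 * n - 1 := ramseyNumber_book_eq hconn hk hcard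
    (isContained_or_book_isContained_compl hconn hk hn hcard (by omega) hl)
  refine ⟨hr, hconn, ?_⟩
  have h3 : (book k).chromaticNumber.toNat = 3 := by rw [chromaticNumber_book hk]; rfl
  have hn0 : 0 < n := lt_of_lt_of_le (by positivity) hn
  rw [hr, chromaticSurplus_book hk, h3, Nat.card_eq_fintype_card, hcard]
  omega
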